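/- Regard $\mathbb H^2$ as a right quaternionic vector space, identify $\mathbb C^4\cong\mathbb H^2$ by $(z_1,z_2,z_3,z_4)\mapsto(z_1+jz_2,\,z_3+jz_4)$ (complex linear for right multiplication by complex numbers on $\mathbb H^2$), and let $\pi\colon\mathbb{CP}^3\to\mathbb{HP}^1=S^4$, $e\mapsto e\mathbb H$, be the twistor projection. Identify a neighbourhood of the sphere below with an open subset of $\mathbb H$ by the conformal chart $x\mapsto[x:1]$, with inverse $[p:q]\mapsto pq^{-1}$; in particular the tangent spaces of $\mathbb{HP}^1$ there become $\mathbb H$. Orient $\mathbb{HP}^1$ so that $(1,i,j,-k)$ is positive. Let $S^3\subset\mathbb{HP}^1$ be the set of isotropic quaternionic lines of $\langle v,w\rangle=\bar v_1w_1-\bar v_2w_2$, and $Q=\pi^{-1}(S^3)\subset\mathbb{CP}^3$. Choose either orientation of $S^3$, and let $N$ be the unit normal field of $S^3$ such that $N$ followed by a positive basis of $T_xS^3$ is a positive basis of $T_x\mathbb{HP}^1$. The tangent sphere bundle $SS^3$ (oriented tangent lines, represented by the unit tangent vectors $(x,v)$, $x\in S^3$, $v\in T_xS^3$) carries LeBrun's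 CR structure: with $p\colon SS^3\to S^3$ the bundle projection, the Levi distribution is $H_{(x,v)}=\{X\in T_{(x,v)}SS^3 : dp(X)\perp v\}$. Splitting $X$ into its horizontal and vertical part by the Levi-Civita connection of the round metric, with both parts regarded as vectors of $v^\perp\subset T_xS^3$, the complex structure on $H_{(x,v)}$ is $a\mapsto v\times a$ on each part, where $\times$ is the cross product of the oriented Euclidean space $T_xS^3$. The set $Q$ carries the CR structure induced from $\mathbb{CP}^3$: the Levi distribution is $TQ\cap i\,TQ$ with multiplication by $i$. Then: 1. The map $x\mapsto[x:1]$ is a bijection from the unit sphere $\{|x|=1\}\subset\mathbb H$ onto $S^3\subset\mathbb{HP}^1$, and $Q$ is the set of null lines of the Hermitian form $\bar z_1w_1+\bar z_2w_2-\bar z_3w_3-\bar z_4w_4$ of signature $(2,2)$ on $\mathbb C^4$. 2. For every $e\in Q$ over $x\in S^3$ there is a unique real linear $J_e\in\mathrm{End}(T_x\mathbb{HP}^1)$ with $d\pi_e(i\,w)=J_e(d\pi_e(w))$ for all $w\in T_e\mathbb{CP}^3$. It is an almost complex structure compatible with the conformal metric and the orientation, and $e\mapsto J_e$ is a bijection from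 $\pi^{-1}(x)$ to the set of all such $J$. Moreover $J\mapsto J(N_x)$ is a bijection from that set to the unit sphere of $T_xS^3$. 3. The resulting map $Q\to SS^3$ over $S^3$, $e\mapsto[J_e(N)]$, is a CR isomorphism: a diffeomorphism whose differential maps the Levi distribution of $Q$ onto that of $SS^3$ and intertwines the complex structures. -/

import Mathlib

open scoped Quaternion Manifold ContDiff Topology RealInnerProductSpace

noncomputable section

namespace TwistorCR

/-! ### Complex projective space as a complex manifold -/

/-- Complex projective space of dimension `n`. -/
abbrev CP (n : ℕ) : Type := Projectivization ℂ (Fin (n + 1) → ℂ)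

/-- The quotient topology of `ℂ^(n+1) ∖ {0} → CP n`. -/
instance instTopologicalSpaceCP (n : ℕ) : TopologicalSpace (CP n) :=
  TopologicalSpace.coinduced
    (Projectivization.mk' ℂ : {v : Fin (n + 1) → ℂ // v ≠ 0} → CP n) inferInstance

theorem isQuotientMap_mk' (n : ℕ) :
    Topology.IsQuotientMap (Projectivization.mk' ℂ : {v : Fin (n + 1) → ℂ // v ≠ 0} → CP n) :=
  ⟨⟨rfl⟩, fun e => ⟨⟨e.rep, e.rep_nonzero⟩, e.mk_rep⟩⟩

/-- The domain `{[z] | z i ≠ 0}` of the `i`-th affine chart. -/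
def chartDomain {n : ℕ} (i : Fin (n + 1)) : Set (CP n) := {e | e.rep i ≠ 0}

/-- The `i`-th affine coordinates `[z] ↦ (z m / z i)`, `m ≠ i`. -/
def chartFun {n : ℕ} (i : Fin (n + 1)) (e : CP n) : Fin n → ℂ :=
  fun k => e.rep (i.succAbove k) / e.rep i

theorem insertNth_one_ne_zero {n : ℕ} (i : Fin (n + 1)) (w : Fin n → ℂ) :
    (i.insertNth (1 : ℂ) w : Fin (n + 1) → ℂ) ≠ 0 := by
  intro h
  have := congrFun h i
  simp at this

/-- The inverse of the `i`-th affine chart: the point with `z i = 1` and the given other entries. -/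
def chartInv {n : ℕ} (i : Fin (n + 1)) (w : Fin n → ℂ) : CP n :=
  Projectivization.mk ℂ (i.insertNth (1 : ℂ) w : Fin (n + 1) → ℂ) (insertNth_one_ne_zero i w)

theorem mk_mem_chartDomain {n : ℕ} (i : Fin (n + 1)) (z : Fin (n + 1) → ℂ) (hz : z ≠ 0) :
    Projectivization.mk ℂ z hz ∈ chartDomain i ↔ z i ≠ 0 := by
  obtain ⟨a, ha⟩ := Projectivization.exists_smul_eq_mk_rep ℂ z hz
  simp only [chartDomain, Set.mem_ofPred_eq, ← ha, Pi.smul_apply, Units.smul_def, smul_eq_mul]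
  simp

theorem isOpen_chartDomain {n : ℕ} (i : Fin (n + 1)) : IsOpen (chartDomain i) := by
  rw [← (isQuotientMap_mk' n).isOpen_preimage]
  have : (Projectivization.mk' ℂ : {v : Fin (n + 1) → ℂ // v ≠ 0} → CP n) ⁻¹' chartDomain i
      = {v | v.1 i ≠ 0} := by
    ext v
    exact mk_mem_chartDomain i v.1 v.2
  rw [this]
  exact isOpen_ne_fun ((continuous_apply i).comp continuous_subtype_val) continuous_const

theorem chartFun_mk {n : ℕ} (i : Fin (n + 1)) (z : Fin (n + 1) → ℂ) (hz : z ≠ 0) :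
    chartFun i (Projectivization.mk ℂ z hz) = fun k => z (i.succAbove k) / z i := by
  obtain ⟨a, ha⟩ := Projectivization.exists_smul_eq_mk_rep ℂ z hz
  funext k
  simp only [chartFun, ← ha, Pi.smul_apply, Units.smul_def, smul_eq_mul]
  exact mul_div_mul_left _ _ a.ne_zero

/-- The `i`-th affine chart of complex projective space. -/
def affineChart {n : ℕ} (i : Fin (n + 1)) : OpenPartialHomeomorph (CP n) (Fin n → ℂ) where
  toFun := chartFun i
  invFun := chartInv i
  source := chartDomain i
  target := Set.univ
  map_source' _ _ := Set.mem_univ _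
  map_target' w _ := by simp [chartInv, mk_mem_chartDomain]
  left_inv' e he := by
    obtain ⟨z, hz, rfl⟩ : ∃ z, ∃ hz : z ≠ 0, Projectivization.mk ℂ z hz = e :=
      ⟨e.rep, e.rep_nonzero, e.mk_rep⟩
    rw [mk_mem_chartDomain] at he
    rw [chartFun_mk, chartInv, Projectivization.mk_eq_mk_iff']
    refine ⟨(z i)⁻¹, ?_⟩
    funext m
    rcases Fin.eq_self_or_eq_succAbove i m with rfl | ⟨k, rfl⟩
    · simp [he]
    · simp [div_eq_inv_mul]
  right_inv' w _ := by
    rw [chartInv, chartFun_mk]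
    funext k
    simp
  open_source := isOpen_chartDomain i
  open_target := isOpen_univ
  continuousOn_toFun := by
    rw [(isQuotientMap_mk' n).continuousOn_isOpen_iff (isOpen_chartDomain i)]
    have h : chartFun i ∘ (Projectivization.mk' ℂ : {v : Fin (n + 1) → ℂ // v ≠ 0} → CP n)
        = fun v k => v.1 (i.succAbove k) / v.1 i := by
      funext v
      exact chartFun_mk i v.1 v.2
    rw [h]
    refine continuousOn_pi.2 fun k => ContinuousOn.div
      ((continuous_apply _).comp continuous_subtype_val).continuousOn
      ((continuous_apply _).comp continuous_subtype_val).continuousOn ?_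
    intro v hv
    exact (mk_mem_chartDomain i v.1 v.2).1 hv
  continuousOn_invFun := by
    refine Continuous.continuousOn ?_
    have hc : Continuous fun w : Fin n → ℂ =>
        (⟨i.insertNth (1 : ℂ) w, insertNth_one_ne_zero i w⟩ : {v : Fin (n + 1) → ℂ // v ≠ 0}) := by
      refine Continuous.subtype_mk (continuous_pi fun m => ?_) _
      rcases Fin.eq_self_or_eq_succAbove i m with rfl | ⟨k, rfl⟩
      · simpa using continuous_const
      · simpa using continuous_apply k
    exact (isQuotientMap_mk' n).continuous.comp hc

theorem exists_mem_chartDomain {n : ℕ} (e : CP n) : ∃ i, e ∈ chartDomain i := by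
  by_contra h
  push Not at h
  exact e.rep_nonzero (funext fun i => by simpa [chartDomain] using h i)

instance instChartedSpaceCP (n : ℕ) : ChartedSpace (Fin n → ℂ) (CP n) where
  atlas := Set.range affineChart
  chartAt e := affineChart (exists_mem_chartDomain e).choose
  mem_chart_source e := (exists_mem_chartDomain e).choose_spec
  chart_mem_atlas _ := Set.mem_range_self _

theorem contDiffOn_transition {n : ℕ} (i j : Fin (n + 1)) :
    ContDiffOn ℂ ω ((affineChart i).symm ≫ₕ affineChart j : (Fin n → ℂ) → (Fin n → ℂ))
      ((affineChart i).symm ≫ₕ affineChart j).source := by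
  have hm : ∀ m : Fin (n + 1), ContDiff ℂ ω
      fun w : Fin n → ℂ => (i.insertNth (1 : ℂ) w : Fin (n + 1) → ℂ) m := by
    intro m
    rcases Fin.eq_self_or_eq_succAbove i m with rfl | ⟨k, rfl⟩
    · simpa using contDiff_const
    · simpa using contDiff_apply ℂ ℂ k
  have h : ((affineChart i).symm ≫ₕ affineChart j : (Fin n → ℂ) → (Fin n → ℂ)) =
      fun w k => (i.insertNth (1 : ℂ) w : Fin (n + 1) → ℂ) (j.succAbove k) /
        (i.insertNth (1 : ℂ) w : Fin (n + 1) → ℂ) j := by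
    funext w
    exact chartFun_mk j _ (insertNth_one_ne_zero i w)
  rw [h]
  refine contDiffOn_pi.2 fun k => ((hm _).contDiffOn).div (hm _).contDiffOn ?_
  intro w hw
  rw [OpenPartialHomeomorph.trans_source] at hw
  exact (mk_mem_chartDomain j _ (insertNth_one_ne_zero i w)).1 hw.2

/-- Complex projective space is a complex (analytic) manifold. -/
instance instIsManifoldCP (n : ℕ) : IsManifold 𝓘(ℂ, Fin n → ℂ) ω (CP n) := by
  refine isManifold_of_contDiffOn _ _ _ ?_
  rintro _ _ ⟨i, rfl⟩ ⟨j, rfl⟩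
  simpa using contDiffOn_transition i j

/-- The underlying real manifold of complex projective space. -/
instance instIsManifoldRealCP (n : ℕ) : IsManifold 𝓘(ℝ, Fin n → ℂ) ω (CP n) := by
  refine isManifold_of_contDiffOn _ _ _ ?_
  rintro _ _ ⟨i, rfl⟩ ⟨j, rfl⟩
  simpa using (contDiffOn_transition i j).restrict_scalars ℝ

/-- Multiplication by `i` on the real tangent space of a complex manifold at `p`; the real
tangent space is the model vector space `E`, via the holomorphic chart at `p`. -/
def tangentI {E : Type*} [NormedAddCommGroup E] [NormedSpace ℂ E] {M : Type*} [TopologicalSpace M]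
    [ChartedSpace E M] (p : M) (w : TangentSpace 𝓘(ℝ, E) p) : TangentSpace 𝓘(ℝ, E) p :=
  let w' : E := w
  (Complex.I • w' : E)

/-! ### Submanifolds, their tangent vectors, and maps between them

Smooth curves in, and smooth maps between, embedded submanifolds `S` of `M` and `T` of `N`
are described through the ambient manifolds. -/

section Submanifolds

variable {E : Type*} [NormedAddCommGroup E] [NormedSpace ℝ E]
  {M : Type*} [TopologicalSpace M] [ChartedSpace E M]
  {F : Type*} [NormedAddCommGroup F] [NormedSpace ℝ F]
  {N : Type*} [TopologicalSpace N] [ChartedSpace F N]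

/-- `γ` is a smooth curve in `S ⊆ M`. -/
def IsSmoothCurve {S : Set M} (γ : ℝ → S) : Prop :=
  ContMDiff 𝓘(ℝ, ℝ) 𝓘(ℝ, E) ∞ fun t => (γ t : M)

/-- The velocity at time `0` of a curve in `S ⊆ M`, a tangent vector of `M` at `γ 0`. -/
def velocity {S : Set M} (γ : ℝ → S) : TangentSpace 𝓘(ℝ, E) (γ 0 : M) :=
  mfderiv 𝓘(ℝ, ℝ) 𝓘(ℝ, E) (fun t => (γ t : M)) 0 (1 : ℝ)

/-- The tangent vectors of `S ⊆ M` at `p`: the velocities of smooth curves in `S` through `p`. -/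
def tangentSet (S : Set M) (p : S) : Set (TangentSpace 𝓘(ℝ, E) (p : M)) :=
  {w | ∃ γ : ℝ → S, IsSmoothCurve (E := E) γ ∧ γ 0 = p ∧ (velocity (E := E) γ : E) = (w : E)}

/-- A map `S → T` is smooth if near every point of `S` it is the restriction of a smooth map
from an open subset of `M` to `N`. -/
def IsSmoothMap {S : Set M} {T : Set N} (f : S → T) : Prop :=
  ∀ p : S, ∃ (U : Set M) (g : M → N), IsOpen U ∧ (p : M) ∈ U ∧
    ContMDiffOn 𝓘(ℝ, E) 𝓘(ℝ, F) ∞ g U ∧ ∀ q : S, (q : M) ∈ U → g q = f q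

/-- The differential of `f : S → T` at `p` takes `w` to `w'`: some smooth curve in `S` through `p`
has velocity `w`, and its image under `f` has velocity `w'`. -/
def DifferentialMaps {S : Set M} {T : Set N} (f : S → T) (p : S)
    (w : TangentSpace 𝓘(ℝ, E) (p : M)) (w' : TangentSpace 𝓘(ℝ, F) (f p : N)) : Prop :=
  ∃ γ : ℝ → S, IsSmoothCurve (E := E) γ ∧ γ 0 = p ∧
    (velocity (E := E) γ : E) = (w : E) ∧ (velocity (E := F) (fun t => f (γ t)) : F) = (w' : F)

/-- `f` is a CR isomorphism from `S` with Levi distribution `H` and complex structure `J` on it to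
`T` with Levi distribution `H'` and complex structure `J'`: a diffeomorphism whose differential
maps `H` onto `H'` and satisfies `df ∘ J = J' ∘ df` on `H`. -/
structure IsCRIsomorphism {S : Set M} {T : Set N}
    (H : (p : S) → Set (TangentSpace 𝓘(ℝ, E) (p : M)))
    (J : (p : S) → TangentSpace 𝓘(ℝ, E) (p : M) → TangentSpace 𝓘(ℝ, E) (p : M))
    (H' : (q : T) → Set (TangentSpace 𝓘(ℝ, F) (q : N)))
    (J' : (q : T) → TangentSpace 𝓘(ℝ, F) (q : N) → TangentSpace 𝓘(ℝ, F) (q : N))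
    (f : S ≃ T) : Prop where
  smooth : IsSmoothMap (E := E) (F := F) f
  smooth_symm : IsSmoothMap (E := F) (F := E) f.symm
  levi : ∀ (p : S) w w', DifferentialMaps f p w w' → (w ∈ H p ↔ w' ∈ H' (f p))
  complex : ∀ (p : S) w w', w ∈ H p → DifferentialMaps f p w w' →
    DifferentialMaps f p (J p w) (J' (f p) w')

end Submanifolds

/-- The Levi distribution `TS ∩ i TS` of a subset `S` of a complex manifold. Its complex structure
is multiplication by `i`. -/
def hypersurfaceLevi {E : Type*} [NormedAddCommGroup E] [NormedSpace ℂ E]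
    {M : Type*} [TopologicalSpace M] [ChartedSpace E M] (S : Set M) (p : S) :
    Set (TangentSpace 𝓘(ℝ, E) (p : M)) :=
  {w | w ∈ tangentSet S p ∧ tangentI (p : M) w ∈ tangentSet S p}

/-! ### The twistor projection `CP³ → HP¹` -/

/-- The quaternionic projective line: quaternionic lines in the right vector space `ℍ²`. -/
abbrev HP1 : Type := Projectivization ℍ[ℝ]ᵐᵒᵖ (Fin 2 → ℍ[ℝ])

/-- The quaternion `j`. -/
def quaternionJ : ℍ[ℝ] := ⟨0, 0, 1, 0⟩

@[simp] theorem re_quaternionJ : quaternionJ.re = 0 := rfl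
@[simp] theorem imI_quaternionJ : quaternionJ.imI = 0 := rfl
@[simp] theorem imJ_quaternionJ : quaternionJ.imJ = 1 := rfl
@[simp] theorem imK_quaternionJ : quaternionJ.imK = 0 := rfl

/-- The quaternion `a + j b`. Right multiplication by `c ∈ ℂ` takes it to `a c + j (b c)`. -/
def toQuaternion (a b : ℂ) : ℍ[ℝ] := (a : ℍ[ℝ]) + quaternionJ * (b : ℍ[ℝ])

/-- The identification of `ℂ⁴` with `ℍ²`, complex linear for right multiplication on `ℍ²`. -/
def toQuaternions (z : Fin 4 → ℂ) : Fin 2 → ℍ[ℝ] :=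
  ![toQuaternion (z 0) (z 1), toQuaternion (z 2) (z 3)]

theorem toQuaternion_mul (a b c : ℂ) :
    toQuaternion (c * a) (c * b) = toQuaternion a b * (c : ℍ[ℝ]) := by
  ext <;> simp [toQuaternion] <;> ring

theorem toQuaternion_eq_zero {a b : ℂ} (h : toQuaternion a b = 0) : a = 0 ∧ b = 0 := by
  rw [Quaternion.ext_iff] at h
  simp [toQuaternion] at h
  exact ⟨Complex.ext h.1 h.2.1, Complex.ext h.2.2.1 (by simpa using h.2.2.2)⟩

theorem toQuaternions_smul (c : ℂ) (z : Fin 4 → ℂ) :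
    toQuaternions (c • z) = MulOpposite.op (c : ℍ[ℝ]) • toQuaternions z := by
  funext m
  fin_cases m <;> simp [toQuaternions, toQuaternion_mul]

theorem toQuaternions_ne_zero {z : Fin 4 → ℂ} (hz : z ≠ 0) : toQuaternions z ≠ 0 := by
  intro h
  have h0 := toQuaternion_eq_zero (a := z 0) (b := z 1) (by simpa [toQuaternions] using congrFun h 0)
  have h1 := toQuaternion_eq_zero (a := z 2) (b := z 3) (by simpa [toQuaternions] using congrFun h 1)
  apply hz
  funext m
  fin_cases m
  exacts [h0.1, h0.2, h1.1, h1.2]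

/-- The twistor projection, taking a complex line `e` to the quaternionic line `e ℍ`. -/
def twistorProjection : CP 3 → HP1 :=
  Projectivization.lift
    (fun z => Projectivization.mk ℍ[ℝ]ᵐᵒᵖ (toQuaternions z.1) (toQuaternions_ne_zero z.2))
    (by
      rintro ⟨a, ha⟩ ⟨b, hb⟩ t (rfl : a = t • b)
      rw [Projectivization.mk_eq_mk_iff']
      exact ⟨MulOpposite.op (t : ℍ[ℝ]), (toQuaternions_smul t b).symm⟩)

/-- The affine point `[x : 1]` of `HP¹`. -/
def affinePoint (x : ℍ[ℝ]) : HP1 :=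
  Projectivization.mk ℍ[ℝ]ᵐᵒᵖ ![x, 1] (fun h => by simpa using congrFun h 1)

/-- The affine coordinate `[p : q] ↦ p q⁻¹` of `HP¹` (with junk value at the point `q = 0`); it is
inverse to `affinePoint`, and conformal for the round metric of `S⁴ = HP¹`. Through it the tangent
spaces of `HP¹` at affine points are identified with `ℍ`. -/
def affineCoordinate : HP1 → ℍ[ℝ] :=
  Projectivization.lift (fun v => v.1 0 * (v.1 1)⁻¹)
    (by
      rintro ⟨a, ha⟩ ⟨b, hb⟩ t (rfl : a = t • b)
      have ht : t.unop ≠ 0 := by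
        intro h
        apply ha
        have : t = 0 := by simpa using h
        simp [this]
      simp [mul_inv_rev, mul_assoc, mul_inv_cancel_left₀ ht])

/-- The indefinite quaternionic Hermitian form `v̄₁ w₁ - v̄₂ w₂` on `ℍ²`. -/
def quaternionicForm (v w : Fin 2 → ℍ[ℝ]) : ℍ[ℝ] := star (v 0) * w 0 - star (v 1) * w 1

/-- The three-sphere in `HP¹`: the isotropic quaternionic lines. -/
def sphereInHP1 : Set HP1 := {l | ∀ v ∈ l.submodule, quaternionicForm v v = 0}

/-- The Hermitian form `z̄₁ w₁ + z̄₂ w₂ - z̄₃ w₃ - z̄₄ w₄` of signature `(2,2)` on `ℂ⁴`. -/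
def hermitianForm (z w : Fin 4 → ℂ) : ℂ :=
  star (z 0) * w 0 + star (z 1) * w 1 - star (z 2) * w 2 - star (z 3) * w 3

/-- The real quadric `Q = π⁻¹(S³)`. -/
def quadric : Set (CP 3) := twistorProjection ⁻¹' sphereInHP1

/-! ### Orientations and Hermitian almost complex structures on the tangent spaces of `HP¹` -/

/-- The basis `1, i, j, k` of the quaternions. -/
def quaternionBasis : Module.Basis (Fin 4) ℝ ℍ[ℝ] := QuaternionAlgebra.basisOneIJK (-1) 0 (-1)

/-- The volume form, on the tangent spaces `ℍ` of `HP¹`, of the Euclidean metric and of the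
orientation of `HP¹ = S⁴` used in its twistor fibration: `1, i, j, -k` is positive. -/
def volumeHP1 : ℍ[ℝ] [⋀^Fin 4]→ₗ[ℝ] ℝ := -quaternionBasis.det

/-- The fibre of the twistor space: almost complex structures on a tangent space `ℍ` of `HP¹` that
are compatible with the conformal metric and the orientation. -/
def hermitianStructures : Set (ℍ[ℝ] →ₗ[ℝ] ℍ[ℝ]) :=
  {J | (∀ a, J (J a) = -a) ∧ (∀ a b, ⟪J a, J b⟫ = ⟪a, b⟫) ∧
    ∀ a b, 0 ≤ volumeHP1 ![a, J a, b, J b]}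

/-- `J` is the almost complex structure on the tangent space of `HP¹` at `π(e)` that the point `e`
of the twistor space `CP³` stands for: the differential of the twistor projection at `e` intertwines
multiplication by `i` and `J`. -/
def IsTwistorStructure (e : CP 3) (J : ℍ[ℝ] →ₗ[ℝ] ℍ[ℝ]) : Prop :=
  ∀ w : TangentSpace 𝓘(ℝ, Fin 3 → ℂ) e,
    (mfderiv 𝓘(ℝ, Fin 3 → ℂ) 𝓘(ℝ, ℍ[ℝ]) (fun e' => affineCoordinate (twistorProjection e')) e
      (tangentI e w) : ℍ[ℝ]) =
    J (mfderiv 𝓘(ℝ, Fin 3 → ℂ) 𝓘(ℝ, ℍ[ℝ]) (fun e' => affineCoordinate (twistorProjection e')) e w)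

/-! ### The tangent sphere bundle of the three-sphere

`S³` is the unit sphere of `ℍ`. Its orientation is encoded by a sign `ε = ±1`: the oriented unit
normal at `x` is `ε x`, and `v₁, v₂, v₃` in `x^⊥` is positive if `ε x, v₁, v₂, v₃` is positive. -/

/-- The oriented unit normal of `S³` in `HP¹`. -/
def unitNormal (ε : ℝ) (x : ℍ[ℝ]) : ℍ[ℝ] := ε • x

/-- The cross product of the oriented Euclidean space `x^⊥`, the tangent space of `S³` at `x`: the
vector that represents `u ↦ vol(N, v, w, u)`, written in the orthonormal basis `1, i, j, k`. -/
def crossProduct (ε : ℝ) (x v w : ℍ[ℝ]) : ℍ[ℝ] :=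
  ∑ m, volumeHP1 ![unitNormal ε x, v, w, quaternionBasis m] • quaternionBasis m

/-- The tangent sphere bundle `SS³`, as the bundle of unit tangent vectors `v` at `x ∈ S³`. -/
def tangentSphereBundle : Set (ℍ[ℝ] × ℍ[ℝ]) := {p | ‖p.1‖ = 1 ∧ ‖p.2‖ = 1 ∧ ⟪p.1, p.2⟫ = 0}

/-- The Levi distribution of `SS³`: the base component of a tangent vector `X` at `(x, v)` is
perpendicular to `v`. -/
def sphereBundleLevi (p : tangentSphereBundle) :
    Set (TangentSpace 𝓘(ℝ, ℍ[ℝ] × ℍ[ℝ]) (p : ℍ[ℝ] × ℍ[ℝ])) :=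
  {X | X ∈ tangentSet tangentSphereBundle p ∧ ⟪(X : ℍ[ℝ] × ℍ[ℝ]).1, p.1.2⟫ = 0}

/-- The vertical part of a tangent vector `X` of `SS³` at `(x, v)`, with respect to the Levi-Civita
connection of the round sphere: the projection to `x^⊥` of the derivative of `v`. -/
def verticalPart (p X : ℍ[ℝ] × ℍ[ℝ]) : ℍ[ℝ] := X.2 - ⟪X.2, p.1⟫ • p.1

/-- The horizontal lift to `(x, v)` of a tangent vector `a` of `S³` at `x`: along a curve with
velocity `a`, a parallel field starting at `v` has derivative `-⟨a, v⟩ x` in `ℍ`. -/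
def horizontalLift (p : ℍ[ℝ] × ℍ[ℝ]) (a : ℍ[ℝ]) : ℍ[ℝ] × ℍ[ℝ] := (a, -⟪a, p.2⟫ • p.1)

/-- The complex structure of the Levi distribution of `SS³` at `(x, v)`: the cross product with `v`
on the horizontal and on the vertical part. -/
def sphereBundleJ (ε : ℝ) (p : tangentSphereBundle)
    (X : TangentSpace 𝓘(ℝ, ℍ[ℝ] × ℍ[ℝ]) (p : ℍ[ℝ] × ℍ[ℝ])) :
    TangentSpace 𝓘(ℝ, ℍ[ℝ] × ℍ[ℝ]) (p : ℍ[ℝ] × ℍ[ℝ]) :=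
  (horizontalLift p.1 (crossProduct ε p.1.1 p.1.2 (X : ℍ[ℝ] × ℍ[ℝ]).1) +
    (0, crossProduct ε p.1.1 p.1.2 (verticalPart p.1 X)) : ℍ[ℝ] × ℍ[ℝ])

end TwistorCR

end

open TwistorCR

noncomputable section

namespace TwistorCR

/-! ### Quaternion algebra -/

/-! Let `(p, q)` in `ℍ²` be homogeneous coordinates of `e`, so that `e` lies over `x = p q⁻¹`. For
`s` commuting with `i`, the function `p s q⁻¹` has derivative `(dp s - p s q⁻¹ dq) q⁻¹`. Replacing
`(dp, dq)` by `(dp i, dq i)` multiplies this on the right by the imaginary unit `u = q i q⁻¹`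
(`quotientDeriv_I_smul`). With `s = 1` this says that `J_e` is right multiplication by `u`
(`isTwistorStructure_iff`).

The orientation in which `1, i, j, -k` is positive is the one for which the Hermitian structures on
`ℍ` are exactly the right multiplications by imaginary units (`mem_hermitianStructures_iff`). Every
such unit has the form `q i q⁻¹`, with `q` unique up to a right factor in `ℂ`; this gives the
bijections on the fibres.

Since `J_e N = ε x u = ε p i q⁻¹`, the map to the sphere bundle is `[z] ↦ (p q⁻¹, ε p i q⁻¹)`. Both
components are quotients of the above kind, with `s = 1` and `s = i`, so its differential turns
multiplication by `i` into right multiplication by the same `u` on both. The cross product with `v =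
ε x u` is also right multiplication by `u` on the plane orthogonal to `x` and `v`
(`crossProduct_eq`), which gives compatibility with LeBrun's structure (`sphereBundleJ_eq`).

The hypersurface `|p| = |q|` has tangent condition `dx ⊥ x`. Applied to `i w` it reads `dx u ⊥ x`,
that is `dx ⊥ x u`, so the Levi distributions correspond (`mem_hypersurfaceLevi_quadric_iff`). This
needs every vector with `dx ⊥ x` to be the velocity of a curve in `Q` (`mem_tangentSet_quadric`). -/

/-- The quaternion `i`. -/
def quaternionI : ℍ[ℝ] := ⟨0, 1, 0, 0⟩

@[simp] theorem re_quaternionI : quaternionI.re = 0 := rfl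
@[simp] theorem imI_quaternionI : quaternionI.imI = 1 := rfl
@[simp] theorem imJ_quaternionI : quaternionI.imJ = 0 := rfl
@[simp] theorem imK_quaternionI : quaternionI.imK = 0 := rfl

theorem quaternionI_mul_self : quaternionI * quaternionI = -1 := by
  ext <;> simp

theorem inner_eq_components (a b : ℍ[ℝ]) :
    ⟪a, b⟫ = a.re * b.re + a.imI * b.imI + a.imJ * b.imJ + a.imK * b.imK := by
  rw [Quaternion.inner_def]
  simp

theorem inner_self_eq_normSq (a : ℍ[ℝ]) : ⟪a, a⟫ = Quaternion.normSq a := rfl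

theorem volumeHP1_apply (a b c d : ℍ[ℝ]) : volumeHP1 ![a, b, c, d] =
    -(Matrix.det !![a.re, a.imI, a.imJ, a.imK; b.re, b.imI, b.imJ, b.imK;
      c.re, c.imI, c.imJ, c.imK; d.re, d.imI, d.imJ, d.imK]) := by
  rw [volumeHP1, AlternatingMap.neg_apply, Module.Basis.det_apply, ← Matrix.det_transpose]
  congr 2
  ext m n
  fin_cases n <;> fin_cases m <;> rfl

/-- The volume form in a left-invariant frame. -/
theorem volumeHP1_mul_left {u : ℍ[ℝ]} (hu : u.re = 0) (x c m : ℍ[ℝ]) :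
    volumeHP1 ![x, x * u, x * c, m] = ⟪x, x⟫ / 2 * ⟪x * (c * u - u * c), m⟫ := by
  rw [volumeHP1_apply, inner_eq_components, inner_eq_components]
  simp [Matrix.det_succ_row_zero, Fin.sum_univ_succ, Fin.succAbove, hu]
  ring

theorem inner_mul_mul_right (a b u : ℍ[ℝ]) : ⟪a * u, b * u⟫ = ⟪u, u⟫ * ⟪a, b⟫ := by
  simp only [inner_eq_components]
  simp
  ring

theorem inner_mul_mul_left (a b u : ℍ[ℝ]) : ⟪u * a, u * b⟫ = ⟪u, u⟫ * ⟪a, b⟫ := by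
  simp only [inner_eq_components]
  simp
  ring

theorem inner_mul_right_of_re_eq_zero {u : ℍ[ℝ]} (hu : u.re = 0) (a b : ℍ[ℝ]) :
    ⟪a * u, b⟫ = -⟪a, b * u⟫ := by
  simp only [inner_eq_components]
  simp [hu]
  ring

theorem inner_mul_self_right {u : ℍ[ℝ]} (hu : u.re = 0) (a : ℍ[ℝ]) : ⟪a, a * u⟫ = 0 := by
  have := inner_mul_right_of_re_eq_zero hu a a
  rw [real_inner_comm] at this
  linarith

/-! ### Hermitian structures as right multiplications by imaginary units. -/

/-- The imaginary units of the quaternions. -/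
def imaginaryUnits : Set ℍ[ℝ] := {u | u * u = -1}

theorem re_eq_zero_and_inner_self_eq_one {u : ℍ[ℝ]} (hu : u ∈ imaginaryUnits) :
    u.re = 0 ∧ ⟪u, u⟫ = 1 := by
  have hu : u * u = -1 := hu
  have h1 : ⟪u, u⟫ = 1 := by
    have h := congrArg Quaternion.normSq hu
    rw [map_mul, Quaternion.normSq_neg, map_one] at h
    rw [inner_self_eq_normSq]
    nlinarith [Quaternion.normSq_nonneg (a := u)]
  refine ⟨?_, h1⟩
  have h := congrArg QuaternionAlgebra.re hu
  rw [inner_eq_components] at h1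
  simp at h
  nlinarith

theorem mem_imaginaryUnits {u : ℍ[ℝ]} : u ∈ imaginaryUnits ↔ u.re = 0 ∧ ⟪u, u⟫ = 1 := by
  refine ⟨re_eq_zero_and_inner_self_eq_one, fun ⟨h0, h1⟩ => ?_⟩
  rw [inner_eq_components, h0] at h1
  change u * u = -1
  ext <;> simp [h0] <;> linarith

theorem mul_mul_inv_mem_imaginaryUnits {q : ℍ[ℝ]} (hq : q ≠ 0) :
    q * quaternionI * q⁻¹ ∈ imaginaryUnits := by
  change q * quaternionI * q⁻¹ * (q * quaternionI * q⁻¹) = -1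
  calc _ = q * quaternionI * (q⁻¹ * q) * quaternionI * q⁻¹ := by simp only [mul_assoc]
    _ = q * (quaternionI * quaternionI) * q⁻¹ := by
      rw [inv_mul_cancel₀ hq, mul_one, mul_assoc q]
    _ = -1 := by rw [quaternionI_mul_self]; simp [hq]

theorem mulRight_mem_hermitianStructures {u : ℍ[ℝ]} (hu : u ∈ imaginaryUnits) :
    LinearMap.mulRight ℝ u ∈ hermitianStructures := by
  obtain ⟨h0, h1⟩ := re_eq_zero_and_inner_self_eq_one hu
  refine ⟨fun a => ?_, fun a b => ?_, fun a b => ?_⟩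
  · have : u * u = -1 := hu
    simp [mul_assoc, this]
  · rw [LinearMap.mulRight_apply, LinearMap.mulRight_apply, inner_mul_mul_right, h1, one_mul]
  · rw [LinearMap.mulRight_apply, LinearMap.mulRight_apply]
    rcases eq_or_ne a 0 with rfl | ha
    · rw [AlternatingMap.map_coord_zero _ 0 rfl]
    · obtain ⟨c, rfl⟩ : ∃ c, b = a * c := ⟨a⁻¹ * b, by rw [mul_inv_cancel_left₀ ha]⟩
      rw [volumeHP1_mul_left h0, mul_assoc a c u, inner_mul_mul_left]
      -- Right and left multiplication by a unit are isometries, so `c * u` and `u * c` have equal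
      -- norm; expanding the square of their difference gives the identity, hence the sign of the
      -- volume.
      have h : 2 * ⟪c * u - u * c, c * u⟫ = ⟪c * u - u * c, c * u - u * c⟫ := by
        have e1 := inner_mul_mul_right c c u
        have e2 := inner_mul_mul_left c c u
        simp only [inner_sub_left, inner_sub_right, real_inner_comm (c * u) (u * c)]
        linarith
      have h2 : (0 : ℝ) ≤ ⟪c * u - u * c, c * u - u * c⟫ := real_inner_self_nonneg
      have h3 : (0 : ℝ) ≤ ⟪a, a⟫ := real_inner_self_nonneg
      have h4 : (0 : ℝ) ≤ ⟪c * u - u * c, c * u⟫ := by linarith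
      positivity

/-- Gram's identity for the triple product of imaginary quaternions that are orthogonal. -/
theorem inner_mul_sq_of_orthogonal {u b c : ℍ[ℝ]} (hu : u.re = 0) (hb : b.re = 0) (hc : c.re = 0)
    (hub : ⟪u, b⟫ = 0) (huc : ⟪u, c⟫ = 0) (hbc : ⟪b, c⟫ = 0) :
    ⟪b * u, c⟫ ^ 2 = ⟪u, u⟫ * ⟪b, b⟫ * ⟪c, c⟫ := by
  have h : ⟪b * u, c⟫ ^ 2 = ⟪u, u⟫ * ⟪b, b⟫ * ⟪c, c⟫ + 2 * ⟪u, b⟫ * ⟪u, c⟫ * ⟪b, c⟫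
      - ⟪u, u⟫ * ⟪b, c⟫ ^ 2 - ⟪b, b⟫ * ⟪u, c⟫ ^ 2 - ⟪c, c⟫ * ⟪u, b⟫ ^ 2 := by
    simp only [inner_eq_components]
    simp [hu, hb, hc]
    ring
  rw [h, hub, huc, hbc]
  ring

/-- The unit must be `u = J 1`. For `b` orthogonal to `1` and `u`, the vectors `J b` and `b * u`
both lie on the line orthogonal to `1`, `u`, `b` and have the same length, so they agree up to sign;
positivity of the volume of `1, J 1, b, J b` fixes the sign. -/
theorem exists_eq_mulRight_of_mem_hermitianStructures {J : ℍ[ℝ] →ₗ[ℝ] ℍ[ℝ]}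
    (hJ : J ∈ hermitianStructures) : ∃ u ∈ imaginaryUnits, J = LinearMap.mulRight ℝ u := by
  obtain ⟨hsq, hinner, hvol⟩ := hJ
  have hskew : ∀ a b, ⟪J a, b⟫ = -⟪a, J b⟫ := fun a b => by
    rw [← hinner a (J b), hsq, inner_neg_right, neg_neg]
  have hself : ∀ a, ⟪a, J a⟫ = 0 := fun a => by
    have := hskew a a
    rw [real_inner_comm] at this
    linarith
  have hone : ∀ a : ℍ[ℝ], ⟪(1 : ℍ[ℝ]), a⟫ = a.re := fun a => by simp [inner_eq_components]
  have hu0 : (J 1).re = 0 := by rw [← hone, hself]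
  have hu1 : ⟪J 1, J 1⟫ = 1 := by rw [hinner, hone]; simp
  have hu := mem_imaginaryUnits.2 ⟨hu0, hu1⟩
  refine ⟨J 1, hu, ?_⟩
  have key : ∀ b : ℍ[ℝ], b.re = 0 → ⟪J 1, b⟫ = 0 → J b = b * J 1 := by
    intro b hb hub
    have hc : (J b).re = 0 := by rw [← hone, ← neg_eq_zero, ← hskew, hub]
    have huc : ⟪J 1, J b⟫ = 0 := by rw [hinner, hone, hb]
    have hsq' := inner_mul_sq_of_orthogonal hu0 hb hc hub huc (hself b)
    rw [hu1, hinner b b, one_mul] at hsq'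
    have hpos := hvol 1 b
    have hv := volumeHP1_mul_left hu0 1 b (J b)
    simp only [one_mul] at hv
    have hcomm : b * J 1 - J 1 * b = (2 : ℝ) • (b * J 1) := by
      have h2 : ⟪J 1, b⟫ = (J 1).imI * b.imI + (J 1).imJ * b.imJ + (J 1).imK * b.imK := by
        rw [inner_eq_components, hb]; ring
      rw [h2] at hub
      ext <;> simp [hu0, hb] <;> linarith
    have hone1 : ⟪(1 : ℍ[ℝ]), (1 : ℍ[ℝ])⟫ = 1 := by simp
    rw [hv, hcomm, inner_smul_left, hone1] at hpos
    simp only [conj_trivial] at hpos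
    -- The squares agree by Gram's identity and both sides are nonnegative. This is equality in
    -- Cauchy–Schwarz, which forces `J b = b * J 1`.
    have hval : ⟪b * J 1, J b⟫ = ⟪b, b⟫ := by
      have h0 : (0 : ℝ) ≤ ⟪b, b⟫ := real_inner_self_nonneg
      have h0' : (0 : ℝ) ≤ ⟪b * J 1, J b⟫ := by linarith
      rw [← sq_eq_sq₀ h0' h0, hsq', sq]
    have hzero : ⟪J b - b * J 1, J b - b * J 1⟫ = 0 := by
      rw [inner_sub_left, inner_sub_right, inner_sub_right, hinner, inner_mul_mul_right, hu1,
        real_inner_comm (b * J 1) (J b), hval]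
      ring
    exact sub_eq_zero.1 (inner_self_eq_zero.1 hzero)
  refine LinearMap.ext fun a => ?_
  rw [LinearMap.mulRight_apply]
  have ha : a = (a.re • (1 : ℍ[ℝ]) + ⟪J 1, a⟫ • J 1) + (a - a.re • (1 : ℍ[ℝ]) - ⟪J 1, a⟫ • J 1) := by
    abel
  have hb := key (a - a.re • (1 : ℍ[ℝ]) - ⟪J 1, a⟫ • J 1) (by simp [hu0]) (by
    rw [inner_sub_right, inner_sub_right, inner_smul_right, inner_smul_right, hu1,
      real_inner_comm 1 (J 1), hone (J 1), hu0]
    ring)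
  have huu : J 1 * J 1 = -1 := hu
  conv_lhs => rw [ha, map_add, hb, map_add, map_smul, map_smul, hsq]
  conv_rhs => rw [ha, add_mul, add_mul, smul_mul_assoc, smul_mul_assoc, huu, one_mul]

theorem mem_hermitianStructures_iff {J : ℍ[ℝ] →ₗ[ℝ] ℍ[ℝ]} :
    J ∈ hermitianStructures ↔ ∃ u ∈ imaginaryUnits, J = LinearMap.mulRight ℝ u :=
  ⟨exists_eq_mulRight_of_mem_hermitianStructures, by
    rintro ⟨u, hu, rfl⟩
    exact mulRight_mem_hermitianStructures hu⟩

/-! ### Cross products on the three-sphere as right multiplications. -/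

theorem inner_quaternionBasis (y : ℍ[ℝ]) (m : Fin 4) :
    ⟪y, quaternionBasis m⟫ = quaternionBasis.repr y m := by
  rw [inner_eq_components]
  change quaternionBasis.repr y 0 * quaternionBasis.repr (quaternionBasis m) 0 +
    quaternionBasis.repr y 1 * quaternionBasis.repr (quaternionBasis m) 1 +
    quaternionBasis.repr y 2 * quaternionBasis.repr (quaternionBasis m) 2 +
    quaternionBasis.repr y 3 * quaternionBasis.repr (quaternionBasis m) 3 = _
  rw [Module.Basis.repr_self]
  fin_cases m <;> simp

/-- Writing `a = x * c`, orthogonality makes `c` imaginary and anticommuting with `u`, so the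
commutator in `volumeHP1_mul_left` is `2 c u`. The sign `ε` occurs in both the normal and the
tangent vector and cancels: the result is the same for both orientations. -/
theorem crossProduct_eq {ε : ℝ} (hε : ε * ε = 1) {x u a : ℍ[ℝ]} (hx : ⟪x, x⟫ = 1)
    (hu : u ∈ imaginaryUnits) (hxa : ⟪x, a⟫ = 0) (hua : ⟪x * u, a⟫ = 0) :
    crossProduct ε x (ε • (x * u)) a = a * u := by
  obtain ⟨h0, h1⟩ := re_eq_zero_and_inner_self_eq_one hu
  have hx0 : x ≠ 0 := by
    rintro rfl
    simp at hx
  obtain ⟨c, rfl⟩ : ∃ c, a = x * c := ⟨x⁻¹ * a, by rw [mul_inv_cancel_left₀ hx0]⟩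
  have hc : c.re = 0 := by
    have h := inner_mul_mul_left 1 c x
    rw [mul_one, hxa, hx, inner_eq_components] at h
    simpa using h.symm
  rw [inner_mul_mul_left, hx, one_mul, inner_eq_components, h0] at hua
  have hvol : ∀ m, volumeHP1 ![unitNormal ε x, ε • (x * u), x * c, m] = ⟪x * c * u, m⟫ := by
    intro m
    have hcomm : c * u - u * c = (2 : ℝ) • (c * u) := by
      ext <;> simp [h0, hc] <;> linarith
    have h := volumeHP1_mul_left h0 x c m
    rw [hcomm, hx, mul_smul_comm, inner_smul_left, ← mul_assoc] at h
    have h2 : volumeHP1 ![unitNormal ε x, ε • (x * u), x * c, m]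
        = ε * ε * volumeHP1 ![x, x * u, x * c, m] := by
      rw [volumeHP1_apply, volumeHP1_apply, unitNormal]
      simp only [Matrix.det_succ_row_zero]
      simp [Fin.sum_univ_succ, Fin.succAbove]
      ring
    rw [h2, hε, h, conj_trivial, mul_assoc x c u]
    ring
  simp only [crossProduct, hvol]
  generalize x * c * u = y
  conv_rhs => rw [← quaternionBasis.sum_repr y]
  refine Finset.sum_congr rfl fun m _ => ?_
  congr 1
  exact inner_quaternionBasis y m

/-! ### Calculus on complex projective space in homogeneous coordinates -/

section Homogeneous

variable {n : ℕ}

/-- The index of the preferred affine chart at `e`. -/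
def chartIndex (e : CP n) : Fin (n + 1) := (exists_mem_chartDomain e).choose

theorem mem_chartDomain_chartIndex (e : CP n) : e ∈ chartDomain (chartIndex e) :=
  (exists_mem_chartDomain e).choose_spec

/-- The homogeneous coordinates of `e` for which the preferred coordinate is `1`. -/
def normRep (e : CP n) : Fin (n + 1) → ℂ :=
  (chartIndex e).insertNth (1 : ℂ) (chartFun (chartIndex e) e)

theorem normRep_ne_zero (e : CP n) : normRep e ≠ 0 := insertNth_one_ne_zero _ _

theorem mk_normRep (e : CP n) : Projectivization.mk ℂ (normRep e) (normRep_ne_zero e) = e :=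
  (affineChart (chartIndex e)).left_inv (mem_chartDomain_chartIndex e)

/-- The linear map that inserts a zero in the `i`-th place. -/
def insertZero (i : Fin (n + 1)) : (Fin n → ℂ) →L[ℂ] (Fin (n + 1) → ℂ) :=
  LinearMap.toContinuousLinearMap
    { toFun := fun w => i.insertNth (0 : ℂ) w
      map_add' := fun v w => by
        funext m
        rcases Fin.eq_self_or_eq_succAbove i m with rfl | ⟨k, rfl⟩ <;> simp
      map_smul' := fun c w => by
        funext m
        rcases Fin.eq_self_or_eq_succAbove i m with rfl | ⟨k, rfl⟩ <;> simp }

@[simp] theorem insertZero_apply_self (i : Fin (n + 1)) (w : Fin n → ℂ) : insertZero i w i = 0 :=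
  Fin.insertNth_apply_same (α := fun _ => ℂ) i 0 w

@[simp] theorem insertZero_apply_succAbove (i : Fin (n + 1)) (w : Fin n → ℂ) (k : Fin n) :
    insertZero i w (i.succAbove k) = w k :=
  Fin.insertNth_apply_succAbove (α := fun _ => ℂ) i 0 w k

theorem insertNth_one_eq (i : Fin (n + 1)) (w : Fin n → ℂ) :
    (i.insertNth (1 : ℂ) w : Fin (n + 1) → ℂ) = Pi.single i 1 + insertZero i w := by
  funext m
  rcases Fin.eq_self_or_eq_succAbove i m with rfl | ⟨k, rfl⟩ <;> simp

theorem hasFDerivAt_insertNth_one (i : Fin (n + 1)) (w : Fin n → ℂ) :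
    HasFDerivAt (fun w : Fin n → ℂ => (i.insertNth (1 : ℂ) w : Fin (n + 1) → ℂ))
      ((insertZero i).restrictScalars ℝ) w := by
  simp only [insertNth_one_eq]
  exact (((insertZero i).restrictScalars ℝ).hasFDerivAt).const_add _

theorem contDiff_insertNth_one (i : Fin (n + 1)) :
    ContDiff ℝ ∞ (fun w : Fin n → ℂ => (i.insertNth (1 : ℂ) w : Fin (n + 1) → ℂ)) := by
  simp only [insertNth_one_eq]
  exact contDiff_const.add ((insertZero i).restrictScalars ℝ).contDiff

/-- The derivative at `e` of the homogeneous coordinates with preferred coordinate `1`. -/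
def tangentLift (e : CP n) : (Fin n → ℂ) →L[ℂ] (Fin (n + 1) → ℂ) := insertZero (chartIndex e)

variable {V : Type*} [NormedAddCommGroup V] [NormedSpace ℝ V]

/-- In the preferred chart, `F` is `Φ` composed with the affine embedding that inserts a `1`, so
calculus on projective space reduces to calculus on the vector space of homogeneous coordinates. -/
theorem contMDiffAt_of_homogeneous {F : CP n → V} {Φ : (Fin (n + 1) → ℂ) → V}
    (h : ∀ z hz, F (Projectivization.mk ℂ z hz) = Φ z) {e : CP n}
    (hΦ : ContDiffAt ℝ ∞ Φ (normRep e)) :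
    ContMDiffAt 𝓘(ℝ, Fin n → ℂ) 𝓘(ℝ, V) ∞ F e := by
  have hch : ContMDiffAt 𝓘(ℝ, Fin n → ℂ) 𝓘(ℝ, Fin n → ℂ) ∞
      (extChartAt 𝓘(ℝ, Fin n → ℂ) e) e := contMDiffAt_extChartAt
  have hcomp : ContDiffAt ℝ ∞ (fun w : Fin n → ℂ => F (chartInv (chartIndex e) w))
      (extChartAt 𝓘(ℝ, Fin n → ℂ) e e) := by
    have : (fun w : Fin n → ℂ => F (chartInv (chartIndex e) w)) =
        Φ ∘ fun w : Fin n → ℂ => ((chartIndex e).insertNth (1 : ℂ) w : Fin (n + 1) → ℂ) := by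
      funext w
      exact h _ _
    rw [this]
    exact ContDiffAt.comp _ hΦ (contDiff_insertNth_one _).contDiffAt
  refine (hcomp.contMDiffAt.comp e hch).congr_of_eventuallyEq ?_
  filter_upwards [(isOpen_chartDomain (chartIndex e)).mem_nhds (mem_chartDomain_chartIndex e)]
    with e' he'
  exact congrArg F ((affineChart (chartIndex e)).left_inv he').symm

theorem hasMFDerivAt_of_homogeneous {F : CP n → V} {Φ : (Fin (n + 1) → ℂ) → V}
    (h : ∀ z hz, F (Projectivization.mk ℂ z hz) = Φ z) {e : CP n}
    (hΦ : ContDiffAt ℝ ∞ Φ (normRep e)) {Φ' : (Fin (n + 1) → ℂ) →L[ℝ] V}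
    (hΦ' : HasFDerivAt Φ Φ' (normRep e)) :
    HasMFDerivAt 𝓘(ℝ, Fin n → ℂ) 𝓘(ℝ, V) F e (Φ' ∘L (tangentLift e).restrictScalars ℝ) := by
  refine ⟨(contMDiffAt_of_homogeneous h hΦ).continuousAt, ?_⟩
  have : writtenInExtChartAt 𝓘(ℝ, Fin n → ℂ) 𝓘(ℝ, V) e F =
      Φ ∘ fun w : Fin n → ℂ => ((chartIndex e).insertNth (1 : ℂ) w : Fin (n + 1) → ℂ) := by
    funext w
    exact h _ _
  rw [this]
  exact (HasFDerivAt.comp (chartFun (chartIndex e) e) hΦ'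
    (hasFDerivAt_insertNth_one _ _)).hasFDerivWithinAt

/-! ### Curves in projective space given by homogeneous lifts. -/

/-- The line spanned by `z`, with a junk value at `z = 0`. -/
def lineOf (z : Fin (n + 1) → ℂ) : CP n :=
  open Classical in if hz : z ≠ 0 then Projectivization.mk ℂ z hz else chartInv 0 0

theorem lineOf_of_ne_zero {z : Fin (n + 1) → ℂ} (hz : z ≠ 0) :
    lineOf z = Projectivization.mk ℂ z hz := dif_pos hz

theorem lineOf_normRep (e : CP n) : lineOf (normRep e) = e :=
  (lineOf_of_ne_zero (normRep_ne_zero e)).trans (mk_normRep e)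

theorem continuousAt_lineOf {z : Fin (n + 1) → ℂ} (hz : z ≠ 0) : ContinuousAt lineOf z := by
  have ho : IsOpen {z : Fin (n + 1) → ℂ | z ≠ 0} := isOpen_ne
  refine ContinuousOn.continuousAt ?_ (ho.mem_nhds hz)
  rw [continuousOn_iff_continuous_domRestrict]
  exact (isQuotientMap_mk' n).continuous.congr fun v => (lineOf_of_ne_zero v.2).symm

theorem extChartAt_lineOf_eventuallyEq {z : Fin (n + 1) → ℂ} (hz : z ≠ 0) (e : CP n) :
    (fun z => extChartAt 𝓘(ℝ, Fin n → ℂ) e (lineOf z)) =ᶠ[𝓝 z]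
      fun z k => z ((chartIndex e).succAbove k) / z (chartIndex e) := by
  filter_upwards [isOpen_ne.mem_nhds hz] with z' hz'
  rw [lineOf_of_ne_zero hz']
  exact chartFun_mk _ _ _

theorem contMDiffAt_lineOf {z : Fin (n + 1) → ℂ} (hz : z ≠ 0) :
    ContMDiffAt 𝓘(ℝ, Fin (n + 1) → ℂ) 𝓘(ℝ, Fin n → ℂ) ∞ (lineOf (n := n)) z := by
  rw [contMDiffAt_iff_target]
  refine ⟨continuousAt_lineOf hz, ContDiffAt.contMDiffAt ?_⟩
  refine ContDiffAt.congr_of_eventuallyEq ?_ (extChartAt_lineOf_eventuallyEq hz (lineOf z))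
  have hi : z (chartIndex (lineOf z)) ≠ 0 := by
    have := mem_chartDomain_chartIndex (lineOf z)
    generalize chartIndex (lineOf z) = i at this
    rwa [lineOf_of_ne_zero hz, mk_mem_chartDomain] at this
  exact contDiffAt_pi.2 fun k =>
    (ContDiffAt.fun_div (contDiff_apply ℂ ℂ ((chartIndex (lineOf z)).succAbove k)).contDiffAt
      (contDiff_apply ℂ ℂ (chartIndex (lineOf z))).contDiffAt hi).restrict_scalars ℝ

/-- The velocity of a curve in projective space given in homogeneous coordinates. -/
theorem mfderiv_lineOf_comp {ζ : ℝ → Fin (n + 1) → ℂ} {e : CP n} {w : Fin n → ℂ} {c : ℝ → CP n}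
    (h0 : ζ 0 = normRep e) (hζ : HasDerivAt ζ (tangentLift e w) 0) (hc0 : c 0 = e)
    (hc : c =ᶠ[𝓝 0] fun t => lineOf (ζ t)) :
    (mfderiv 𝓘(ℝ, ℝ) 𝓘(ℝ, Fin n → ℂ) c 0 (1 : ℝ) : Fin n → ℂ) = w := by
  subst hc0
  have hne : ζ 0 ≠ 0 := h0 ▸ normRep_ne_zero _
  have hcont : ContinuousAt c 0 :=
    ((continuousAt_lineOf hne).comp hζ.continuousAt).congr hc.symm
  set i := chartIndex (c 0) with hi
  have hev : (fun t => extChartAt 𝓘(ℝ, Fin n → ℂ) (c 0) (c t)) =ᶠ[𝓝 0]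
      fun t k => ζ t (i.succAbove k) / ζ t i := by
    have h2 := hζ.continuousAt.eventually (extChartAt_lineOf_eventuallyEq hne (c 0))
    filter_upwards [hc, h2] with t ht ht2
    rw [ht]
    exact ht2
  have hderiv : HasDerivAt (fun t => extChartAt 𝓘(ℝ, Fin n → ℂ) (c 0) (c t)) w 0 := by
    refine HasDerivAt.congr_of_eventuallyEq (hasDerivAt_pi.2 fun k => ?_) hev
    have hc1 := hasDerivAt_pi.1 hζ
    have hz : ζ 0 i = 1 := by
      rw [h0]
      exact Fin.insertNth_apply_same (α := fun _ => ℂ) i 1 _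
    have h := (hc1 (i.succAbove k)).fun_div (hc1 i) (by rw [hz]; exact one_ne_zero)
    have e1 : tangentLift (c 0) w (i.succAbove k) = w k := insertZero_apply_succAbove i w k
    have e2 : tangentLift (c 0) w i = 0 := insertZero_apply_self i w
    -- The preferred coordinate has value `1` and derivative `0`, so the quotient rule returns just
    -- the derivative of the other coordinate.
    rw [hz, e1, e2] at h
    simpa using h
  have hm : HasMFDerivAt 𝓘(ℝ, ℝ) 𝓘(ℝ, Fin n → ℂ) c 0
      (ContinuousLinearMap.toSpanSingleton ℝ w) :=
    ⟨hcont, hderiv.hasFDerivAt.hasFDerivWithinAt⟩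
  rw [hm.mfderiv]
  exact one_smul ℝ w

end Homogeneous

/-! ### The twistor projection in homogeneous coordinates -/

/-- The quaternion `z m + j z n` as a real linear function of `z ∈ ℂ⁴`. -/
def quaternionOfPair (m n : Fin 4) : (Fin 4 → ℂ) →L[ℝ] ℍ[ℝ] :=
  LinearMap.toContinuousLinearMap
    { toFun := fun z => toQuaternion (z m) (z n)
      map_add' := fun v w => by
        ext <;> (simp [toQuaternion]; try ring)
      map_smul' := fun c w => by
        ext <;> simp [toQuaternion] }

/-- The first quaternionic coordinate on `ℂ⁴ = ℍ²`. -/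
def numerator : (Fin 4 → ℂ) →L[ℝ] ℍ[ℝ] := quaternionOfPair 0 1

/-- The second quaternionic coordinate on `ℂ⁴ = ℍ²`. -/
def denominator : (Fin 4 → ℂ) →L[ℝ] ℍ[ℝ] := quaternionOfPair 2 3

theorem numerator_apply (z : Fin 4 → ℂ) : numerator z = toQuaternion (z 0) (z 1) := rfl

theorem denominator_apply (z : Fin 4 → ℂ) : denominator z = toQuaternion (z 2) (z 3) := rfl

theorem toQuaternions_zero (z : Fin 4 → ℂ) : toQuaternions z 0 = numerator z := rfl

theorem toQuaternions_one (z : Fin 4 → ℂ) : toQuaternions z 1 = denominator z := rfl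

theorem numerator_smul (c : ℂ) (z : Fin 4 → ℂ) : numerator (c • z) = numerator z * (c : ℍ[ℝ]) :=
  toQuaternion_mul _ _ _

theorem denominator_smul (c : ℂ) (z : Fin 4 → ℂ) :
    denominator (c • z) = denominator z * (c : ℍ[ℝ]) :=
  toQuaternion_mul _ _ _

theorem coe_complexI : ((Complex.I : ℂ) : ℍ[ℝ]) = quaternionI := by
  ext <;> simp

/-- The identification of `ℍ²` with `ℂ⁴`. -/
def ofQuaternions : ℍ[ℝ] × ℍ[ℝ] →L[ℝ] (Fin 4 → ℂ) :=
  LinearMap.toContinuousLinearMap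
    { toFun := fun a => ![⟨a.1.re, a.1.imI⟩, ⟨a.1.imJ, -a.1.imK⟩, ⟨a.2.re, a.2.imI⟩,
        ⟨a.2.imJ, -a.2.imK⟩]
      map_add' := fun v w => by
        funext m
        fin_cases m <;> apply Complex.ext <;> simp <;> ring
      map_smul' := fun c w => by
        funext m
        fin_cases m <;> apply Complex.ext <;> simp }

theorem ofQuaternions_apply (a : ℍ[ℝ] × ℍ[ℝ]) : ofQuaternions a =
    ![⟨a.1.re, a.1.imI⟩, ⟨a.1.imJ, -a.1.imK⟩, ⟨a.2.re, a.2.imI⟩, ⟨a.2.imJ, -a.2.imK⟩] := rfl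

@[simp] theorem numerator_ofQuaternions (a : ℍ[ℝ] × ℍ[ℝ]) : numerator (ofQuaternions a) = a.1 := by
  rw [numerator_apply, ofQuaternions_apply]
  ext <;> simp [toQuaternion]

@[simp] theorem denominator_ofQuaternions (a : ℍ[ℝ] × ℍ[ℝ]) :
    denominator (ofQuaternions a) = a.2 := by
  rw [denominator_apply, ofQuaternions_apply]
  ext <;> simp [toQuaternion]

@[simp] theorem ofQuaternions_numerator_denominator (z : Fin 4 → ℂ) :
    ofQuaternions (numerator z, denominator z) = z := by
  rw [ofQuaternions_apply, numerator_apply, denominator_apply]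
  funext m
  fin_cases m <;> apply Complex.ext <;> simp [toQuaternion]

theorem ext_numerator_denominator {z z' : Fin 4 → ℂ} (h : numerator z = numerator z')
    (h' : denominator z = denominator z') : z = z' := by
  rw [← ofQuaternions_numerator_denominator z, h, h', ofQuaternions_numerator_denominator]

theorem ofQuaternions_ne_zero {a : ℍ[ℝ] × ℍ[ℝ]} (ha : a.2 ≠ 0) : ofQuaternions a ≠ 0 := by
  intro h
  have := denominator_ofQuaternions a
  rw [h, map_zero] at this
  exact ha this.symm

/-- The twistor projection in affine coordinates. -/
def baseCoordinate (e : CP 3) : ℍ[ℝ] := affineCoordinate (twistorProjection e)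

/-- The factor `1` is kept so that this and `fibreCoordinate_mk` are the cases `s = 1` and `s = i`
of one quotient `p s q⁻¹`. -/
theorem baseCoordinate_mk (z : Fin 4 → ℂ) (hz : z ≠ 0) :
    baseCoordinate (Projectivization.mk ℂ z hz) = numerator z * 1 * (denominator z)⁻¹ := by
  rw [mul_one]
  rfl

theorem quaternionI_mul_coe (c : ℂ) : quaternionI * (c : ℍ[ℝ]) = (c : ℍ[ℝ]) * quaternionI := by
  ext <;> simp

/-- The function `[z] ↦ p i q⁻¹`, for `(p, q) ∈ ℍ²` the point `z ∈ ℂ⁴`. -/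
def fibreCoordinate : CP 3 → ℍ[ℝ] :=
  Projectivization.lift (fun z => numerator z.1 * quaternionI * (denominator z.1)⁻¹)
    (by
      rintro ⟨a, ha⟩ ⟨b, hb⟩ t (rfl : a = t • b)
      have ht : (t : ℍ[ℝ]) ≠ 0 := by
        intro h
        apply ha
        have : t = 0 := by
          apply Complex.ext
          · simpa using congrArg QuaternionAlgebra.re h
          · simpa using congrArg QuaternionAlgebra.imI h
        simp [this]
      have h1 : numerator (t • b) = numerator b * (t : ℍ[ℝ]) := numerator_smul t b
      have h2 : denominator (t • b) = denominator b * (t : ℍ[ℝ]) := denominator_smul t b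
      simp only [h1, h2, mul_inv_rev, mul_assoc]
      rw [← mul_assoc (t : ℍ[ℝ]) quaternionI, ← quaternionI_mul_coe, mul_assoc quaternionI,
        mul_inv_cancel_left₀ ht])

theorem fibreCoordinate_mk (z : Fin 4 → ℂ) (hz : z ≠ 0) :
    fibreCoordinate (Projectivization.mk ℂ z hz) =
      numerator z * quaternionI * (denominator z)⁻¹ := rfl

theorem contDiffAt_quotient (s : ℍ[ℝ]) {z : Fin 4 → ℂ} (hz : denominator z ≠ 0) :
    ContDiffAt ℝ ∞ (fun z => numerator z * s * (denominator z)⁻¹) z := by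
  have hinv : ContDiffAt ℝ ∞ (fun a : ℍ[ℝ] => a⁻¹) (denominator z) := by
    have := contDiffAt_ringInverse ℝ (n := ∞) (Units.mk0 _ hz)
    rwa [Ring.inverse_eq_inv'] at this
  exact (numerator.contDiff.contDiffAt.mul contDiffAt_const).mul
    (hinv.comp z denominator.contDiff.contDiffAt)

/-- Product rule together with `d(q⁻¹) = -q⁻¹ dq q⁻¹`; the common right factor `q⁻¹` is pulled out
because the argument about multiplication by `i` needs it there. -/
theorem exists_hasFDerivAt_quotient (s : ℍ[ℝ]) {z : Fin 4 → ℂ} (hz : denominator z ≠ 0) :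
    ∃ D : (Fin 4 → ℂ) →L[ℝ] ℍ[ℝ],
      HasFDerivAt (fun z => numerator z * s * (denominator z)⁻¹) D z ∧
      ∀ w, D w = (numerator w * s - numerator z * s * (denominator z)⁻¹ * denominator w) *
        (denominator z)⁻¹ := by
  have h1 : HasFDerivAt (fun z => numerator z * s) _ z :=
    numerator.hasFDerivAt.mul' (hasFDerivAt_const s z)
  have h2 : HasFDerivAt (fun z => (denominator z)⁻¹) _ z :=
    (hasFDerivAt_inv' (𝕜 := ℝ) hz).comp z denominator.hasFDerivAt
  refine ⟨_, h1.mul' h2, fun w => ?_⟩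
  simp
  noncomm_ring

/-- The derivative of `[z] ↦ p s q⁻¹`, for `(p, q) ∈ ℍ²` the point `z ∈ ℂ⁴`. -/
def quotientDeriv (s : ℍ[ℝ]) (e : CP 3) (w : Fin 3 → ℂ) : ℍ[ℝ] :=
  (numerator (tangentLift e w) * s -
    numerator (normRep e) * s * (denominator (normRep e))⁻¹ * denominator (tangentLift e w)) *
    (denominator (normRep e))⁻¹

/-- The imaginary unit `q i q⁻¹`, for `(p, q) ∈ ℍ²` the point `z ∈ ℂ⁴`. -/
def fibreUnit (z : Fin 4 → ℂ) : ℍ[ℝ] := denominator z * quaternionI * (denominator z)⁻¹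

theorem exists_hasMFDerivAt_quotient {s : ℍ[ℝ]} {F : CP 3 → ℍ[ℝ]}
    (hF : ∀ z hz, F (Projectivization.mk ℂ z hz) = numerator z * s * (denominator z)⁻¹)
    {e : CP 3} (he : denominator (normRep e) ≠ 0) :
    ∃ D : (Fin 3 → ℂ) →L[ℝ] ℍ[ℝ],
      HasMFDerivAt 𝓘(ℝ, Fin 3 → ℂ) 𝓘(ℝ, ℍ[ℝ]) F e D ∧ ∀ w, D w = quotientDeriv s e w := by
  obtain ⟨D, hD, hDw⟩ := exists_hasFDerivAt_quotient s he
  exact ⟨_, hasMFDerivAt_of_homogeneous hF (contDiffAt_quotient s he) hD, fun w => hDw _⟩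

/-- Multiplying a tangent vector by `i` puts `i` to the right of `dp` and `dq`. As `s` commutes with
`i`, it can be moved to the right of the bracket, where `i q⁻¹ = q⁻¹ (q i q⁻¹)`. -/
theorem quotientDeriv_I_smul {s : ℍ[ℝ]} (hs : quaternionI * s = s * quaternionI) {e : CP 3}
    (he : denominator (normRep e) ≠ 0) (w : Fin 3 → ℂ) :
    quotientDeriv s e (Complex.I • w) = quotientDeriv s e w * fibreUnit (normRep e) := by
  rw [quotientDeriv, map_smul, numerator_smul, denominator_smul, coe_complexI, quotientDeriv,
    fibreUnit]
  have h : (denominator (normRep e))⁻¹ *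
      (denominator (normRep e) * quaternionI * (denominator (normRep e))⁻¹) =
      quaternionI * (denominator (normRep e))⁻¹ := by
    rw [mul_assoc, inv_mul_cancel_left₀ he]
  rw [mul_assoc (numerator (tangentLift e w) * s - _), h,
    ← mul_assoc (numerator (tangentLift e w) * s - _) quaternionI]
  congr 1
  rw [sub_mul, mul_assoc (numerator _) quaternionI s, hs]
  simp only [mul_assoc]

theorem tangentLift_surjective (e : CP 3) {z : Fin 4 → ℂ} (hz : z (chartIndex e) = 0) :
    ∃ w, tangentLift e w = z := by
  refine ⟨fun k => z ((chartIndex e).succAbove k), ?_⟩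
  funext m
  rcases Fin.eq_self_or_eq_succAbove (chartIndex e) m with h | ⟨k, h⟩
  · rw [h, hz]
    exact insertZero_apply_self _ _
  · rw [h]
    exact insertZero_apply_succAbove _ _ _

theorem quotientDeriv_one_surjective {e : CP 3} (he : denominator (normRep e) ≠ 0) (a : ℍ[ℝ]) :
    ∃ w, quotientDeriv 1 e w = a := by
  -- The vector `(a q, 0)` has derivative `a`. A complex multiple of `normRep e` is then subtracted
  -- to make the preferred coordinate vanish; this changes nothing, since radial vectors are in the
  -- kernel.
  set ζ := ofQuaternions (a * denominator (normRep e), 0) with hζ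
  obtain ⟨w, hw⟩ := tangentLift_surjective e (z := ζ - ζ (chartIndex e) • normRep e) (by
    have : normRep e (chartIndex e) = 1 := Fin.insertNth_apply_same (α := fun _ => ℂ) _ 1 _
    simp [this])
  refine ⟨w, ?_⟩
  rw [quotientDeriv, hw, map_sub, map_sub, numerator_smul, denominator_smul, hζ,
    numerator_ofQuaternions, denominator_ofQuaternions]
  generalize ((ofQuaternions (a * denominator (normRep e), 0) (chartIndex e) : ℂ) : ℍ[ℝ]) = c
  simp only [mul_one, zero_sub, mul_neg, sub_neg_eq_add]
  rw [mul_assoc (numerator _), inv_mul_cancel_left₀ he, sub_add_cancel,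
    mul_inv_cancel_right₀ he]

/-- Uniqueness of `J` holds because the differential of the projection is onto `ℍ`. -/
theorem isTwistorStructure_iff {e : CP 3} (he : denominator (normRep e) ≠ 0)
    {J : ℍ[ℝ] →ₗ[ℝ] ℍ[ℝ]} :
    IsTwistorStructure e J ↔ J = LinearMap.mulRight ℝ (fibreUnit (normRep e)) := by
  obtain ⟨D, hD, hDw⟩ := exists_hasMFDerivAt_quotient baseCoordinate_mk he
  have hiff : IsTwistorStructure e J ↔
      ∀ w : Fin 3 → ℂ, quotientDeriv 1 e (Complex.I • w) = J (quotientDeriv 1 e w) := by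
    have hm : mfderiv 𝓘(ℝ, Fin 3 → ℂ) 𝓘(ℝ, ℍ[ℝ])
      (fun e' => affineCoordinate (twistorProjection e')) e = D := hD.mfderiv
    rw [IsTwistorStructure, hm]
    simp only [← hDw]
    rfl
  rw [hiff]
  constructor
  · intro h
    refine LinearMap.ext fun a => ?_
    obtain ⟨w, rfl⟩ := quotientDeriv_one_surjective he a
    rw [← h, quotientDeriv_I_smul (by rw [mul_one, one_mul]) he, LinearMap.mulRight_apply]
  · rintro rfl w
    rw [quotientDeriv_I_smul (by rw [mul_one, one_mul]) he, LinearMap.mulRight_apply]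

/-! ### The three-sphere and the quadric -/

theorem quaternionicForm_self (v : Fin 2 → ℍ[ℝ]) : quaternionicForm v v =
    ((Quaternion.normSq (v 0) - Quaternion.normSq (v 1) : ℝ) : ℍ[ℝ]) := by
  rw [quaternionicForm, Quaternion.star_mul_self, Quaternion.star_mul_self]
  push_cast
  rfl

theorem mk_mem_sphereInHP1 {v : Fin 2 → ℍ[ℝ]} (hv : v ≠ 0) :
    Projectivization.mk ℍ[ℝ]ᵐᵒᵖ v hv ∈ sphereInHP1 ↔
      Quaternion.normSq (v 0) = Quaternion.normSq (v 1) := by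
  have hform : ∀ w : Fin 2 → ℍ[ℝ], quaternionicForm w w = 0 ↔
      Quaternion.normSq (w 0) = Quaternion.normSq (w 1) := by
    intro w
    rw [quaternionicForm_self, ← sub_eq_zero (a := Quaternion.normSq (w 0))]
    exact Quaternion.coe_injective.eq_iff' Quaternion.coe_zero
  change (∀ w ∈ (Projectivization.mk ℍ[ℝ]ᵐᵒᵖ v hv).submodule, quaternionicForm w w = 0) ↔ _
  rw [Projectivization.submodule_mk]
  constructor
  · intro h
    exact (hform v).1 (h v (Submodule.mem_span_singleton_self v))
  · intro h w hw
    obtain ⟨a, rfl⟩ := Submodule.mem_span_singleton.1 hw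
    rw [hform]
    simp [h]

theorem hermitianForm_self (z : Fin 4 → ℂ) : hermitianForm z z =
    ((Quaternion.normSq (numerator z) - Quaternion.normSq (denominator z) : ℝ) : ℂ) := by
  rw [numerator_apply, denominator_apply, Quaternion.normSq_def', Quaternion.normSq_def',
    hermitianForm]
  apply Complex.ext
  · rw [Complex.ofReal_re]
    simp [toQuaternion]
    ring
  · rw [Complex.ofReal_im]
    simp
    ring

theorem mk_mem_quadric {z : Fin 4 → ℂ} (hz : z ≠ 0) :
    (Projectivization.mk ℂ z hz : CP 3) ∈ quadric ↔
      Quaternion.normSq (numerator z) = Quaternion.normSq (denominator z) :=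
  mk_mem_sphereInHP1 (toQuaternions_ne_zero hz)

/-- Both conditions say `|p| = |q|`, which is unchanged by rescaling the vector. -/
theorem quadric_eq : quadric = {e : CP 3 | ∀ z ∈ e.submodule, hermitianForm z z = 0} := by
  ext e
  induction e using Projectivization.ind with
  | h v hv =>
    rw [mk_mem_quadric hv, Set.mem_ofPred_eq, Projectivization.submodule_mk]
    have hform : ∀ w : Fin 4 → ℂ, hermitianForm w w = 0 ↔
        Quaternion.normSq (numerator w) = Quaternion.normSq (denominator w) := by
      intro w
      rw [hermitianForm_self, ← sub_eq_zero (a := Quaternion.normSq (numerator w))]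
      norm_cast
    constructor
    · intro h w hw
      obtain ⟨a, rfl⟩ := Submodule.mem_span_singleton.1 hw
      rw [hform]
      rw [show numerator (a • v) = _ from numerator_smul a v,
        show denominator (a • v) = _ from denominator_smul a v, map_mul, map_mul, h]
    · intro h
      exact (hform v).1 (h v (Submodule.mem_span_singleton_self v))

theorem twistorProjection_mk_eq_affinePoint {z : Fin 4 → ℂ} (hz : z ≠ 0) (x : ℍ[ℝ]) :
    twistorProjection (Projectivization.mk ℂ z hz) = affinePoint x ↔
      denominator z ≠ 0 ∧ numerator z = x * denominator z := by
  have h1 : twistorProjection (Projectivization.mk ℂ z hz) =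
    Projectivization.mk ℍ[ℝ]ᵐᵒᵖ (toQuaternions z) (toQuaternions_ne_zero hz) := rfl
  rw [h1, affinePoint, Projectivization.mk_eq_mk_iff']
  constructor
  · rintro ⟨a, ha⟩
    have h0 : x * a.unop = numerator z := by
      simpa [toQuaternions_zero] using congrFun ha 0
    have h1 : a.unop = denominator z := by simpa [toQuaternions_one] using congrFun ha 1
    rw [h1] at h0
    refine ⟨fun h => ?_, h0.symm⟩
    rw [h, mul_zero] at h0
    exact hz (ext_numerator_denominator (by rw [← h0, map_zero]) (by rw [h, map_zero]))
  · rintro ⟨-, h⟩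
    refine ⟨MulOpposite.op (denominator z), ?_⟩
    funext m
    fin_cases m
    · simpa [toQuaternions_zero] using h.symm
    · simp [toQuaternions_one]

theorem bijOn_affinePoint :
    Set.BijOn affinePoint (Metric.sphere (0 : ℍ[ℝ]) 1) sphereInHP1 := by
  have hnorm : ∀ x : ℍ[ℝ], x ∈ Metric.sphere (0 : ℍ[ℝ]) 1 ↔ Quaternion.normSq x = 1 := by
    intro x
    rw [mem_sphere_zero_iff_norm, Quaternion.normSq_eq_norm_mul_self]
    constructor
    · intro h
      rw [h, one_mul]
    · intro h
      nlinarith [norm_nonneg x]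
  refine ⟨fun x hx => ?_, fun x _ y _ h => ?_, fun l hl => ?_⟩
  · rw [affinePoint, mk_mem_sphereInHP1]
    simpa using (hnorm x).1 hx
  · rw [affinePoint, affinePoint, Projectivization.mk_eq_mk_iff'] at h
    obtain ⟨a, ha⟩ := h
    have h1 : a.unop = 1 := by simpa using congrFun ha 1
    have h0 : y * a.unop = x := by simpa using congrFun ha 0
    rw [← h0, h1, mul_one]
  · induction l using Projectivization.ind with
    | h v hv =>
      rw [mk_mem_sphereInHP1] at hl
      have h1 : v 1 ≠ 0 := by
        intro h
        rw [h, map_zero, Quaternion.normSq_eq_zero] at hl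
        apply hv
        funext m
        fin_cases m
        exacts [hl, h]
      refine ⟨v 0 * (v 1)⁻¹, ?_, ?_⟩
      · rw [hnorm, map_mul, map_inv₀, hl]
        exact mul_inv_cancel₀ (Quaternion.normSq_ne_zero.2 h1)
      · rw [affinePoint, Projectivization.mk_eq_mk_iff']
        refine ⟨MulOpposite.op (v 1)⁻¹, ?_⟩
        funext m
        fin_cases m
        · simp
        · simp [h1]

/-! ### The points of the quadric as unit tangent vectors of the three-sphere -/

theorem mem_tangentSphereBundle_iff_inner {x v : ℍ[ℝ]} :
    (x, v) ∈ tangentSphereBundle ↔ ⟪x, x⟫ = 1 ∧ ⟪v, v⟫ = 1 ∧ ⟪x, v⟫ = 0 := by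
  have h : ∀ y : ℍ[ℝ], ‖y‖ = 1 ↔ ⟪y, y⟫ = 1 := fun y => by
    rw [real_inner_self_eq_norm_sq, pow_eq_one_iff_of_nonneg (norm_nonneg y) two_ne_zero]
  rw [← h, ← h]
  rfl

/-- Left multiplication by the unit `x` is an isometry taking `1` to `x`, so it maps the imaginary
units onto the unit vectors orthogonal to `x`. -/
theorem mem_tangentSphereBundle_iff {ε : ℝ} (hε : ε * ε = 1) {x v : ℍ[ℝ]} :
    (x, v) ∈ tangentSphereBundle ↔ ⟪x, x⟫ = 1 ∧ ∃ u ∈ imaginaryUnits, v = ε • (x * u) := by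
  rw [mem_tangentSphereBundle_iff_inner]
  refine and_congr_right fun hx => ?_
  have hx0 : x ≠ 0 := by
    rintro rfl
    simp at hx
  constructor
  · rintro ⟨hv, hxv⟩
    refine ⟨ε • (x⁻¹ * v), ?_, ?_⟩
    · obtain ⟨c, rfl⟩ : ∃ c, v = x * c := ⟨x⁻¹ * v, by rw [mul_inv_cancel_left₀ hx0]⟩
      rw [inv_mul_cancel_left₀ hx0, mem_imaginaryUnits, inner_smul_left, inner_smul_right]
      rw [inner_mul_mul_left, hx, one_mul] at hv
      have h := inner_mul_mul_left 1 c x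
      rw [mul_one, hxv, hx, inner_eq_components] at h
      have hc : c.re = 0 := by simpa using h.symm
      refine ⟨by simp [hc], ?_⟩
      rw [hv, conj_trivial, mul_one, hε]
    · rw [mul_smul_comm, mul_inv_cancel_left₀ hx0, smul_smul, hε, one_smul]
  · rintro ⟨u, hu, rfl⟩
    obtain ⟨h0, h1⟩ := re_eq_zero_and_inner_self_eq_one hu
    rw [inner_smul_left, inner_smul_right, inner_smul_right, inner_mul_mul_left, hx, h1,
      inner_mul_self_right h0, conj_trivial]
    exact ⟨by linarith, by ring⟩

theorem bijOn_hermitianStructures {ε : ℝ} (hε : ε * ε = 1) {x : ℍ[ℝ]} (hx : ⟪x, x⟫ = 1) :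
    Set.BijOn (fun J : ℍ[ℝ] →ₗ[ℝ] ℍ[ℝ] => J (unitNormal ε x))
      hermitianStructures {v | (x, v) ∈ tangentSphereBundle} := by
  have hx0 : x ≠ 0 := by
    rintro rfl
    simp at hx
  have hε0 : ε ≠ 0 := by
    rintro rfl
    simp at hε
  have hN : ∀ u, LinearMap.mulRight ℝ u (unitNormal ε x) = ε • (x * u) := fun u => by
    rw [LinearMap.mulRight_apply, unitNormal, smul_mul_assoc]
  refine ⟨fun J hJ => ?_, fun J hJ J' hJ' h => ?_, fun v hv => ?_⟩
  · obtain ⟨u, hu, rfl⟩ := mem_hermitianStructures_iff.1 hJ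
    exact (mem_tangentSphereBundle_iff hε).2 ⟨hx, u, hu, hN u⟩
  · obtain ⟨u, hu, rfl⟩ := mem_hermitianStructures_iff.1 hJ
    obtain ⟨u', hu', rfl⟩ := mem_hermitianStructures_iff.1 hJ'
    simp only [hN] at h
    rw [mul_left_cancel₀ hx0 (smul_right_injective _ hε0 h)]
  · obtain ⟨-, u, hu, rfl⟩ := (mem_tangentSphereBundle_iff hε).1 hv
    exact ⟨_, mulRight_mem_hermitianStructures hu, hN u⟩

theorem denominator_ne_zero_of_mem_quadric {z : Fin 4 → ℂ} (hz : z ≠ 0)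
    (h : (Projectivization.mk ℂ z hz : CP 3) ∈ quadric) : denominator z ≠ 0 := by
  intro hd
  rw [mk_mem_quadric, hd, map_zero, Quaternion.normSq_eq_zero] at h
  exact hz (ext_numerator_denominator (by rw [h, map_zero]) (by rw [hd, map_zero]))

theorem denominator_normRep_ne_zero {e : CP 3} (he : e ∈ quadric) :
    denominator (normRep e) ≠ 0 := by
  rw [← mk_normRep e] at he
  exact denominator_ne_zero_of_mem_quadric _ he

theorem fibreCoordinate_eq {e : CP 3} (he : denominator (normRep e) ≠ 0) :
    fibreCoordinate e = baseCoordinate e * fibreUnit (normRep e) := by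
  conv_lhs => rw [← mk_normRep e]
  conv_rhs => rw [← mk_normRep e]
  rw [fibreCoordinate_mk, baseCoordinate_mk, mk_normRep, fibreUnit, mul_one,
    mul_assoc (numerator _) _ (_ * _), mul_assoc (denominator _), inv_mul_cancel_left₀ he,
    mul_assoc]

theorem inner_baseCoordinate {e : CP 3} (he : e ∈ quadric) :
    ⟪baseCoordinate e, baseCoordinate e⟫ = 1 := by
  have h0 := denominator_normRep_ne_zero he
  rw [← mk_normRep e] at he ⊢
  rw [mk_mem_quadric] at he
  rw [baseCoordinate_mk, mul_one, inner_self_eq_normSq, map_mul, map_inv₀, he,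
    mul_inv_cancel₀ (Quaternion.normSq_ne_zero.2 h0)]

/-- The point `(x, ε p i q⁻¹)`, `x = p q⁻¹`, for `(p, q) ∈ ℍ²` the point `z ∈ ℂ⁴`. -/
def twistorPair (ε : ℝ) (e : CP 3) : ℍ[ℝ] × ℍ[ℝ] := (baseCoordinate e, ε • fibreCoordinate e)

theorem twistorPair_mem {ε : ℝ} (hε : ε * ε = 1) {e : CP 3} (he : e ∈ quadric) :
    twistorPair ε e ∈ tangentSphereBundle := by
  have h0 := denominator_normRep_ne_zero he
  exact (mem_tangentSphereBundle_iff hε).2 ⟨inner_baseCoordinate he, _,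
    mul_mul_inv_mem_imaginaryUnits h0, by rw [fibreCoordinate_eq h0, fibreUnit]⟩

/-- Equality of `q i q⁻¹` and `q' i q'⁻¹` says that `c = q'⁻¹ q` commutes with `i`, hence is
complex. Equality of the base points then makes `c` the scalar relating the two vectors. -/
theorem mk_eq_mk_of_quotient_eq {z z' : Fin 4 → ℂ} (hz : z ≠ 0) (hz' : z' ≠ 0)
    (hd : denominator z ≠ 0) (hd' : denominator z' ≠ 0)
    (h : numerator z * (denominator z)⁻¹ = numerator z' * (denominator z')⁻¹)
    (hu : fibreUnit z = fibreUnit z') :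
    (Projectivization.mk ℂ z hz : CP 3) = Projectivization.mk ℂ z' hz' := by
  set c := (denominator z')⁻¹ * denominator z with hc
  have hdc : denominator z = denominator z' * c := by rw [hc, mul_inv_cancel_left₀ hd']
  have hcomm : quaternionI * c = c * quaternionI := by
    have h1 : denominator z' * (quaternionI * c) = denominator z' * (c * quaternionI) := by
      calc denominator z' * (quaternionI * c)
          = fibreUnit z' * denominator z := by rw [fibreUnit, hc]; simp only [mul_assoc]
        _ = denominator z * quaternionI := by
          rw [← hu, fibreUnit, mul_assoc, inv_mul_cancel₀ hd, mul_one]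
        _ = denominator z' * (c * quaternionI) := by rw [hdc, mul_assoc]
    exact mul_left_cancel₀ hd' h1
  have hcc : c = ((⟨c.re, c.imI⟩ : ℂ) : ℍ[ℝ]) := by
    have h1 := congrArg QuaternionAlgebra.imK hcomm
    have h2 := congrArg QuaternionAlgebra.imJ hcomm
    simp at h1 h2
    ext <;> simp <;> linarith
  rw [Projectivization.mk_eq_mk_iff']
  refine ⟨⟨c.re, c.imI⟩, ext_numerator_denominator ?_ ?_⟩
  · rw [show numerator ((⟨c.re, c.imI⟩ : ℂ) • z') = _ from numerator_smul _ z', ← hcc,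
      ← inv_mul_cancel_right₀ hd (numerator z), h, hdc, mul_assoc (numerator z'),
      inv_mul_cancel_left₀ hd']
  · rw [show denominator ((⟨c.re, c.imI⟩ : ℂ) • z') = _ from denominator_smul _ z', ← hcc, hdc]

/-! ### Local sections: recovering a complex line from `x` and `u`. -/

theorem exists_mul_add_mul_ne_zero (u : ℍ[ℝ]) : ∃ c, u * c + c * quaternionI ≠ 0 := by
  by_contra! h
  -- Taking `c = 1` forces `u = -i`, and then `c = j` gives `-i j + j i = -2 k`, which is not zero.
  have h1 := h 1
  have h2 := h quaternionJ
  rw [mul_one, one_mul] at h1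
  rw [eq_neg_of_add_eq_zero_left h1] at h2
  have := congrArg QuaternionAlgebra.imK h2
  norm_num at this

/-- For `d = u c + c i`, the vector `(x d, d)` of `ℂ⁴ = ℍ²`. If `u` is an imaginary unit, it spans
the point of `CP³` over `x` that belongs to `u`. -/
def twistorVector (c x u : ℍ[ℝ]) : Fin 4 → ℂ :=
  ofQuaternions (x * (u * c + c * quaternionI), u * c + c * quaternionI)

theorem denominator_twistorVector (c x u : ℍ[ℝ]) :
    denominator (twistorVector c x u) = u * c + c * quaternionI := denominator_ofQuaternions _

theorem numerator_twistorVector (c x u : ℍ[ℝ]) :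
    numerator (twistorVector c x u) = x * denominator (twistorVector c x u) := by
  rw [denominator_twistorVector]
  exact numerator_ofQuaternions _

/-- Since `u² = i² = -1`, the quaternion `d = u c + c i` satisfies `u d = d i`. -/
theorem fibreUnit_twistorVector {c u : ℍ[ℝ]} (hu : u ∈ imaginaryUnits) (x : ℍ[ℝ])
    (hc : u * c + c * quaternionI ≠ 0) : fibreUnit (twistorVector c x u) = u := by
  rw [fibreUnit, denominator_twistorVector, mul_inv_eq_iff_eq_mul₀ hc, add_mul, mul_add,
    ← mul_assoc u u c, show u * u = -1 from hu, mul_assoc c, quaternionI_mul_self, mul_assoc]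
  simp [add_comm]

theorem twistorVector_ne_zero {c u : ℍ[ℝ]} (x : ℍ[ℝ]) (hc : u * c + c * quaternionI ≠ 0) :
    twistorVector c x u ≠ 0 := ofQuaternions_ne_zero hc

theorem lineOf_twistorVector {ε : ℝ} {c x u : ℍ[ℝ]} (hx : ⟪x, x⟫ = 1) (hu : u ∈ imaginaryUnits)
    (hc : u * c + c * quaternionI ≠ 0) : (lineOf (twistorVector c x u) : CP 3) ∈ quadric ∧
      twistorPair ε (lineOf (twistorVector c x u)) = (x, ε • (x * u)) := by
  have hz := twistorVector_ne_zero x hc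
  have hd : denominator (twistorVector c x u) ≠ 0 := by rwa [denominator_twistorVector]
  rw [lineOf_of_ne_zero hz, mk_mem_quadric, twistorPair, baseCoordinate_mk, fibreCoordinate_mk,
    numerator_twistorVector, map_mul, ← inner_self_eq_normSq x, hx, one_mul]
  refine ⟨rfl, Prod.ext ?_ ?_⟩
  · simp [mul_inv_cancel_right₀ hd]
  · change ε • _ = ε • _
    conv_rhs => rw [← fibreUnit_twistorVector hu x hc, fibreUnit]
    simp only [mul_assoc]

/-- `fibreUnit` is defined on vectors; its independence of the representative is read off from
`fibreCoordinate`, which is `x` times it, by cancelling `x`. -/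
theorem fibreUnit_eq_of_mk_eq {z z' : Fin 4 → ℂ} (hz : z ≠ 0) (hz' : z' ≠ 0)
    {x : ℍ[ℝ]} (hx : x ≠ 0) (hx1 : numerator z = x * denominator z)
    (hx2 : numerator z' = x * denominator z')
    (h : (Projectivization.mk ℂ z hz : CP 3) = Projectivization.mk ℂ z' hz') :
    fibreUnit z = fibreUnit z' := by
  have h1 := congrArg fibreCoordinate h
  rw [fibreCoordinate_mk, fibreCoordinate_mk, hx1, hx2] at h1
  simp only [mul_assoc] at h1
  simpa only [fibreUnit, mul_assoc] using mul_left_cancel₀ hx h1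

theorem existsUnique_isTwistorStructure {x : ℍ[ℝ]} (hx : ⟪x, x⟫ = 1) {J : ℍ[ℝ] →ₗ[ℝ] ℍ[ℝ]}
    (hJ : J ∈ hermitianStructures) :
    ∃! e : CP 3, twistorProjection e = affinePoint x ∧ IsTwistorStructure e J := by
  have hx0 : x ≠ 0 := by
    rintro rfl
    simp at hx
  obtain ⟨u, hu, rfl⟩ := mem_hermitianStructures_iff.1 hJ
  have hmul : ∀ {v : ℍ[ℝ]}, LinearMap.mulRight ℝ u = LinearMap.mulRight ℝ v ↔ u = v := by
    intro v
    refine ⟨fun h => ?_, fun h => by rw [h]⟩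
    simpa using LinearMap.congr_fun h 1
  have hproj : ∀ {e : CP 3}, twistorProjection e = affinePoint x ↔
      denominator (normRep e) ≠ 0 ∧ numerator (normRep e) = x * denominator (normRep e) := by
    intro e
    rw [← twistorProjection_mk_eq_affinePoint (normRep_ne_zero e), mk_normRep]
  obtain ⟨c, hc⟩ := exists_mul_add_mul_ne_zero u
  have hz := twistorVector_ne_zero x hc
  have hd : denominator (twistorVector c x u) ≠ 0 := by rwa [denominator_twistorVector]
  refine ⟨Projectivization.mk ℂ (twistorVector c x u) hz, ⟨?_, ?_⟩, ?_⟩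
  · exact (twistorProjection_mk_eq_affinePoint hz x).2 ⟨hd, numerator_twistorVector c x u⟩
  · have h := (twistorProjection_mk_eq_affinePoint hz x).2 ⟨hd, numerator_twistorVector c x u⟩
    obtain ⟨h1, h2⟩ := hproj.1 h
    rw [isTwistorStructure_iff h1, hmul]
    refine (fibreUnit_twistorVector hu x hc).symm.trans ?_
    exact fibreUnit_eq_of_mk_eq hz (normRep_ne_zero _) hx0 (numerator_twistorVector c x u) h2
      (mk_normRep _).symm
  · rintro e ⟨h, hJe⟩
    obtain ⟨h1, h2⟩ := hproj.1 h
    rw [isTwistorStructure_iff h1, hmul] at hJe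
    rw [← mk_normRep e]
    refine mk_eq_mk_of_quotient_eq _ _ h1 hd ?_ ?_
    · rw [h2, numerator_twistorVector, mul_inv_cancel_right₀ h1, mul_inv_cancel_right₀ hd]
    · rw [fibreUnit_twistorVector hu x hc, hJe]

/-- The bijection of the quadric with the tangent sphere bundle. -/
def quadricEquiv {ε : ℝ} (hε : ε * ε = 1) : quadric ≃ tangentSphereBundle :=
  Equiv.ofBijective (fun e => ⟨twistorPair ε e, twistorPair_mem hε e.2⟩) (by
    have hε0 : ε ≠ 0 := by
      rintro rfl
      simp at hε
    constructor
    · rintro ⟨e, he⟩ ⟨e', he'⟩ h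
      have h1 : baseCoordinate e = baseCoordinate e' := congrArg (fun p => p.1.1) h
      have h2 : ε • fibreCoordinate e = ε • fibreCoordinate e' := congrArg (fun p => p.1.2) h
      have hd := denominator_normRep_ne_zero he
      have hd' := denominator_normRep_ne_zero he'
      have h3 := smul_right_injective _ hε0 h2
      have hx0 : baseCoordinate e' ≠ 0 := by
        intro h0
        have := inner_baseCoordinate he'
        simp [h0] at this
      rw [fibreCoordinate_eq hd, fibreCoordinate_eq hd', h1] at h3
      rw [← mk_normRep e, ← mk_normRep e', baseCoordinate_mk, baseCoordinate_mk, mul_one,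
        mul_one] at h1
      refine Subtype.ext ?_
      change e = e'
      rw [← mk_normRep e, ← mk_normRep e']
      exact mk_eq_mk_of_quotient_eq _ _ hd hd' h1 (mul_left_cancel₀ hx0 h3)
    · rintro ⟨⟨x, v⟩, h⟩
      obtain ⟨hx, u, hu, rfl⟩ := (mem_tangentSphereBundle_iff hε).1 h
      obtain ⟨c, hc⟩ := exists_mul_add_mul_ne_zero u
      obtain ⟨h1, h2⟩ := lineOf_twistorVector (ε := ε) hx hu hc
      exact ⟨⟨_, h1⟩, Subtype.ext h2⟩)

/-! ### Smoothness -/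

theorem denominator_normRep_mk_ne_zero_iff {z : Fin 4 → ℂ} (hz : z ≠ 0) :
    denominator (normRep (Projectivization.mk ℂ z hz : CP 3)) ≠ 0 ↔ denominator z ≠ 0 := by
  have h : ∀ {v w : Fin 4 → ℂ} (hv : v ≠ 0) (hw : w ≠ 0), (Projectivization.mk ℂ v hv : CP 3) =
      Projectivization.mk ℂ w hw → denominator v ≠ 0 → denominator w ≠ 0 := by
    intro v w hv hw h hdv hdw
    obtain ⟨a, ha⟩ := (Projectivization.mk_eq_mk_iff' ℂ v w hv hw).1 h
    rw [← ha, show denominator (a • w) = _ from denominator_smul a w, hdw, zero_mul] at hdv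
    exact hdv rfl
  exact ⟨h _ hz (mk_normRep _), h hz _ (mk_normRep _).symm⟩

theorem isOpen_setOf_denominator_ne_zero : IsOpen {e : CP 3 | denominator (normRep e) ≠ 0} := by
  rw [← (isQuotientMap_mk' 3).isOpen_preimage]
  have : (Projectivization.mk' ℂ : {v : Fin 4 → ℂ // v ≠ 0} → CP 3) ⁻¹'
      {e : CP 3 | denominator (normRep e) ≠ 0} = {v | denominator v.1 ≠ 0} := by
    ext v
    exact denominator_normRep_mk_ne_zero_iff v.2
  rw [this]
  exact isOpen_ne_fun (denominator.continuous.comp continuous_subtype_val) continuous_const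

theorem contMDiffAt_twistorPair (ε : ℝ) {e : CP 3} (he : denominator (normRep e) ≠ 0) :
    ContMDiffAt 𝓘(ℝ, Fin 3 → ℂ) 𝓘(ℝ, ℍ[ℝ] × ℍ[ℝ]) ∞ (twistorPair ε) e :=
  contMDiffAt_of_homogeneous (Φ := fun z => (numerator z * 1 * (denominator z)⁻¹,
      ε • (numerator z * quaternionI * (denominator z)⁻¹)))
    (fun z hz => by rw [twistorPair, baseCoordinate_mk, fibreCoordinate_mk])
    ((contDiffAt_quotient 1 he).prodMk
      (contDiffAt_const.fun_smul (contDiffAt_quotient quaternionI he)))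

theorem isSmoothMap_quadricEquiv {ε : ℝ} (hε : ε * ε = 1) :
    IsSmoothMap (E := Fin 3 → ℂ) (F := ℍ[ℝ] × ℍ[ℝ]) (quadricEquiv hε) := fun p =>
  ⟨_, twistorPair ε, isOpen_setOf_denominator_ne_zero, denominator_normRep_ne_zero p.2,
    fun _ he => (contMDiffAt_twistorPair ε he).contMDiffWithinAt, fun _ _ => rfl⟩

theorem isSmoothMap_quadricEquiv_symm {ε : ℝ} (hε : ε * ε = 1) :
    IsSmoothMap (E := ℍ[ℝ] × ℍ[ℝ]) (F := Fin 3 → ℂ) (quadricEquiv hε).symm := by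
  rintro ⟨⟨x, v⟩, h⟩
  -- On the bundle `x⁻¹ = star x`, so this polynomial map extends `u` to all pairs. The extension of
  -- the inverse map only has to land in `CP 3`, not in the quadric, so `U` need not be an imaginary
  -- unit elsewhere. The constant `c` is chosen at the given point and works on a neighbourhood.
  let U : ℍ[ℝ] × ℍ[ℝ] → ℍ[ℝ] := fun p => ε • (star p.1 * p.2)
  have hstar : ContDiff ℝ ∞ fun y : ℍ[ℝ] => star y :=
    (LinearMap.toContinuousLinearMap
      (⟨⟨star, star_add⟩, fun r y => Quaternion.star_smul r y⟩ : ℍ[ℝ] →ₗ[ℝ] ℍ[ℝ])).contDiff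
  have hU : ContDiff ℝ ∞ U :=
    contDiff_const.fun_smul ((hstar.comp contDiff_fst).mul contDiff_snd)
  obtain ⟨c, hc⟩ := exists_mul_add_mul_ne_zero (U (x, v))
  have hW : ContDiff ℝ ∞ fun p => U p * c + c * quaternionI :=
    (hU.mul contDiff_const).add contDiff_const
  have hZ : ContDiff ℝ ∞ fun p => twistorVector c p.1 (U p) :=
    ofQuaternions.contDiff.comp ((contDiff_fst.mul hW).prodMk hW)
  refine ⟨{p | U p * c + c * quaternionI ≠ 0}, fun p => lineOf (twistorVector c p.1 (U p)),
    isOpen_ne_fun hW.continuous continuous_const, hc, fun p hp => ?_, ?_⟩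
  · exact ((contMDiffAt_lineOf (twistorVector_ne_zero p.1 hp)).comp p
      hZ.contDiffAt.contMDiffAt).contMDiffWithinAt
  · rintro ⟨⟨y, w⟩, hy⟩ hyU
    obtain ⟨hy1, u, hu, rfl⟩ := (mem_tangentSphereBundle_iff hε).1 hy
    have hUu : U (y, ε • (y * u)) = u := by
      change ε • (star y * ε • (y * u)) = u
      rw [mul_smul_comm, smul_smul, hε, one_smul, ← mul_assoc, Quaternion.star_mul_self,
        ← inner_self_eq_normSq, hy1, Quaternion.coe_one, one_mul]
    change U (y, ε • (y * u)) * c + c * quaternionI ≠ 0 at hyU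
    simp only [hUu] at hyU ⊢
    obtain ⟨h1, h2⟩ := lineOf_twistorVector (ε := ε) hy1 hu hyU
    have h3 : quadricEquiv hε ⟨_, h1⟩ = ⟨(y, ε • (y * u)), hy⟩ := Subtype.ext h2
    rw [← h3, Equiv.symm_apply_apply]

/-! ### Tangent vectors -/

theorem hasDerivAt_comp_curve {n : ℕ} {V : Type*} [NormedAddCommGroup V] [NormedSpace ℝ V]
    {F : CP n → V} {γ : ℝ → CP n} {D : (Fin n → ℂ) →L[ℝ] V}
    (hF : HasMFDerivAt 𝓘(ℝ, Fin n → ℂ) 𝓘(ℝ, V) F (γ 0) D)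
    (hγ : ContMDiff 𝓘(ℝ, ℝ) 𝓘(ℝ, Fin n → ℂ) ∞ γ) :
    HasDerivAt (fun t => F (γ t))
      (D (mfderiv 𝓘(ℝ, ℝ) 𝓘(ℝ, Fin n → ℂ) γ 0 (1 : ℝ) : Fin n → ℂ)) 0 := by
  have h1 : HasMFDerivAt 𝓘(ℝ, ℝ) 𝓘(ℝ, Fin n → ℂ) γ 0 (mfderiv 𝓘(ℝ, ℝ) 𝓘(ℝ, Fin n → ℂ) γ 0) :=
    ((hγ 0).mdifferentiableAt (by simp)).hasMFDerivAt
  have h2 : HasFDerivAt (fun t => F (γ t))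
      (D ∘L (mfderiv 𝓘(ℝ, ℝ) 𝓘(ℝ, Fin n → ℂ) γ 0 : ℝ →L[ℝ] (Fin n → ℂ))) 0 :=
    (HasMFDerivAt.comp (0 : ℝ) hF h1).hasFDerivAt
  exact h2.hasDerivAt

theorem hasDerivAt_quotient_comp_curve {s : ℍ[ℝ]} {F : CP 3 → ℍ[ℝ]}
    (hF : ∀ z hz, F (Projectivization.mk ℂ z hz) = numerator z * s * (denominator z)⁻¹)
    {γ : ℝ → quadric} (hγ : IsSmoothCurve (E := Fin 3 → ℂ) γ) :
    HasDerivAt (fun t => F (γ t))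
      (quotientDeriv s (γ 0 : CP 3) (velocity (E := Fin 3 → ℂ) γ)) 0 := by
  obtain ⟨D, hD, hDw⟩ := exists_hasMFDerivAt_quotient hF (denominator_normRep_ne_zero (γ 0).2)
  exact (hasDerivAt_comp_curve hD hγ).congr_deriv (hDw _)

theorem inner_eq_zero_of_hasDerivAt {X : ℝ → ℍ[ℝ]} {a : ℍ[ℝ]} (hX : HasDerivAt X a 0)
    (h1 : ∀ t, ⟪X t, X t⟫ = 1) : ⟪X 0, a⟫ = 0 := by
  have h := hX.inner ℝ hX
  simp only [h1] at h
  have h2 := h.unique (hasDerivAt_const 0 (1 : ℝ))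
  rw [real_inner_comm (X 0) a] at h2
  linarith

theorem inner_baseCoordinate_quotientDeriv {p : quadric} {w : Fin 3 → ℂ}
    (hw : w ∈ tangentSet (E := Fin 3 → ℂ) quadric p) :
    ⟪baseCoordinate p, quotientDeriv 1 (p : CP 3) w⟫ = 0 := by
  obtain ⟨γ, hγ, rfl, rfl⟩ := hw
  exact inner_eq_zero_of_hasDerivAt (hasDerivAt_quotient_comp_curve baseCoordinate_mk hγ)
    fun t => inner_baseCoordinate (γ t).2

/-- A smooth reparametrisation of a neighbourhood of `0` by the whole real line. -/
theorem exists_bounded_reparametrisation {s : Set ℝ} (hs : s ∈ 𝓝 0) :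
    ∃ σ : ℝ → ℝ, ContDiff ℝ ∞ σ ∧ σ 0 = 0 ∧ HasDerivAt σ 1 0 ∧ ∀ t, σ t ∈ s := by
  obtain ⟨δ, hδ, hball⟩ := Metric.mem_nhds_iff.1 hs
  refine ⟨fun t => δ / 2 * Real.sin (t / (δ / 2)), ?_, by simp, ?_, fun t => hball ?_⟩
  · exact contDiff_const.mul (Real.contDiff_sin.comp (contDiff_id.div_const _))
  · have h := (((hasDerivAt_id (0 : ℝ)).div_const (δ / 2)).sin).const_mul (δ / 2)
    refine h.congr_deriv ?_
    simp only [id, zero_div, Real.cos_zero, one_mul]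
    exact mul_one_div_cancel (by positivity)
  · rw [mem_ball_zero_iff, Real.norm_eq_abs, abs_mul, abs_of_pos (by positivity : 0 < δ / 2)]
    have := Real.abs_sin_le_one (t / (δ / 2))
    nlinarith

/-- The straight line `Z + s L` of homogeneous coordinates has the right velocity but leaves the
quadric. Dividing its numerator by `‖X‖ = |p| / |q|` restores `|p| = |q|`, and the orthogonality
hypothesis makes `‖X‖` stationary at `0`, so the velocity is unchanged. -/
theorem mem_tangentSet_quadric {p : quadric} {w : Fin 3 → ℂ}
    (h : ⟪baseCoordinate p, quotientDeriv 1 (p : CP 3) w⟫ = 0) :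
    w ∈ tangentSet (E := Fin 3 → ℂ) quadric p := by
  set Z := normRep (p : CP 3) with hZ
  set L := tangentLift (p : CP 3) w
  have hd := denominator_normRep_ne_zero p.2
  have hnorm : Quaternion.normSq (numerator Z) = Quaternion.normSq (denominator Z) := by
    rw [← mk_mem_quadric (normRep_ne_zero _), mk_normRep]
    exact p.2
  have hn : numerator Z ≠ 0 := by
    rw [← Quaternion.normSq_ne_zero, hnorm, Quaternion.normSq_ne_zero]
    exact hd
  let y : ℝ → Fin 4 → ℂ := fun s => Z + s • L
  have hy0 : y 0 = Z := by simp [y]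
  have hy : ContDiff ℝ ∞ y := contDiff_const.add (contDiff_id.smul contDiff_const)
  have hy' : HasDerivAt y L 0 :=
    (((hasDerivAt_id (0 : ℝ)).smul_const L).const_add Z).congr_deriv (one_smul ℝ L)
  let X : ℝ → ℍ[ℝ] := fun s => numerator (y s) * 1 * (denominator (y s))⁻¹
  have hXbase : X 0 = baseCoordinate p := by
    rw [← mk_normRep (p : CP 3), baseCoordinate_mk, ← hZ, ← hy0]
  have hX' : HasDerivAt X (quotientDeriv 1 (p : CP 3) w) 0 := by
    obtain ⟨D, hD, hDw⟩ := exists_hasFDerivAt_quotient 1 hd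
    rw [← hZ, ← hy0] at hD
    exact (hD.comp_hasDerivAt 0 hy').congr_deriv (hDw _)
  have hX0 : ‖X 0‖ = 1 := by
    rw [hXbase, ← pow_eq_one_iff_of_nonneg (norm_nonneg _) two_ne_zero,
      ← real_inner_self_eq_norm_sq, inner_baseCoordinate p.2]
  have hρ' : HasDerivAt (fun s => ‖X s‖⁻¹) 0 0 := by
    have h1 : HasDerivAt (fun s => ‖X s‖ ^ 2) 0 0 :=
      hX'.norm_sq.congr_deriv (by rw [hXbase, h, mul_zero])
    have h2 := h1.sqrt (by simp [hX0])
    simp only [Real.sqrt_sq (norm_nonneg _)] at h2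
    exact (h2.fun_inv (by simp [hX0])).congr_deriv (by simp)
  let ζ : ℝ → Fin 4 → ℂ := fun s =>
    ofQuaternions (‖X s‖⁻¹ • numerator (y s), denominator (y s))
  have hζ0 : ζ 0 = Z := by
    simp only [ζ, hX0, hy0, inv_one, one_smul, ofQuaternions_numerator_denominator]
  have hζ' : HasDerivAt ζ L 0 := by
    have hnum : HasDerivAt (fun s => numerator (y s)) (numerator L) 0 :=
      numerator.hasFDerivAt.comp_hasDerivAt 0 hy'
    have hden : HasDerivAt (fun s => denominator (y s)) (denominator L) 0 :=
      denominator.hasFDerivAt.comp_hasDerivAt 0 hy'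
    refine (ofQuaternions.hasFDerivAt.comp_hasDerivAt (0 : ℝ)
      ((hρ'.fun_smul hnum).prodMk hden)).congr_deriv ?_
    simp [hX0]
  have hG : {s | numerator (y s) ≠ 0 ∧ denominator (y s) ≠ 0} ∈ 𝓝 (0 : ℝ) := by
    refine IsOpen.mem_nhds ?_ ?_
    · exact (isOpen_ne_fun (numerator.continuous.comp hy.continuous) continuous_const).inter
        (isOpen_ne_fun (denominator.continuous.comp hy.continuous) continuous_const)
    · simp only [Set.mem_ofPred_eq, hy0]
      exact ⟨hn, hd⟩
  -- A curve must be smooth and in the quadric for all times, while the construction needs `p` and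
  -- `q` nonzero; the reparametrisation keeps the parameter in that region without changing the
  -- velocity.
  obtain ⟨σ, hσ, hσ0, hσ', hσG⟩ := exists_bounded_reparametrisation hG
  have hζne : ∀ t, ζ (σ t) ≠ 0 := fun t => ofQuaternions_ne_zero (hσG t).2
  have hζsmooth : ∀ t, ContDiffAt ℝ ∞ ζ (σ t) := by
    intro t
    have hXt : X (σ t) ≠ 0 := by
      simp only [X, mul_one]
      exact mul_ne_zero (hσG t).1 (inv_ne_zero (hσG t).2)
    have h1 : ContDiffAt ℝ ∞ X (σ t) :=
      (contDiffAt_quotient 1 (hσG t).2).comp (σ t) hy.contDiffAt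
    have h2 : ContDiffAt ℝ ∞ (fun s => ‖X s‖⁻¹) (σ t) :=
      (h1.norm ℝ hXt).inv (norm_ne_zero_iff.2 hXt)
    exact ofQuaternions.contDiff.contDiffAt.comp (σ t)
      ((h2.fun_smul (numerator.contDiff.comp hy).contDiffAt).prodMk
        (denominator.contDiff.comp hy).contDiffAt)
  have hmem : ∀ t, (lineOf (ζ (σ t)) : CP 3) ∈ quadric := by
    intro t
    rw [lineOf_of_ne_zero (hζne t), mk_mem_quadric]
    simp only [ζ, numerator_ofQuaternions, denominator_ofQuaternions, X, mul_one]
    have h1 := norm_ne_zero_iff.2 (hσG t).1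
    rw [Quaternion.normSq_eq_norm_mul_self, Quaternion.normSq_eq_norm_mul_self, norm_smul,
      norm_inv, norm_norm, norm_mul, norm_inv]
    field_simp
  let γ : ℝ → quadric := fun t => ⟨lineOf (ζ (σ t)), hmem t⟩
  have hγ0 : γ 0 = p := Subtype.ext (by
    change lineOf (ζ (σ 0)) = (p : CP 3)
    rw [hσ0, hζ0, hZ, lineOf_normRep])
  refine ⟨γ, fun t => ?_, hγ0, ?_⟩
  · exact ContMDiffAt.comp (f := fun t => ζ (σ t)) t (contMDiffAt_lineOf (hζne t))
      ((hζsmooth t).comp t hσ.contDiffAt).contMDiffAt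
  · refine mfderiv_lineOf_comp (ζ := fun t => ζ (σ t)) ?_ ?_ (congrArg Subtype.val hγ0)
      Filter.EventuallyEq.rfl
    · rw [hσ0, hζ0]
    · rw [← hσ0] at hζ'
      exact (hζ'.scomp 0 hσ').congr_deriv (one_smul ℝ _)

/-! ### The differential of the bijection -/

theorem isSmoothCurve_quadricEquiv {ε : ℝ} (hε : ε * ε = 1) {γ : ℝ → quadric}
    (hγ : IsSmoothCurve (E := Fin 3 → ℂ) γ) :
    IsSmoothCurve (E := ℍ[ℝ] × ℍ[ℝ]) (fun t => quadricEquiv hε (γ t)) := fun t =>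
  ContMDiffAt.comp (f := fun t => (γ t : CP 3)) t
    (contMDiffAt_twistorPair ε (denominator_normRep_ne_zero (γ t).2)) (hγ t)

theorem velocity_quadricEquiv {ε : ℝ} (hε : ε * ε = 1) {γ : ℝ → quadric}
    (hγ : IsSmoothCurve (E := Fin 3 → ℂ) γ) :
    (velocity (E := ℍ[ℝ] × ℍ[ℝ]) (fun t => quadricEquiv hε (γ t)) : ℍ[ℝ] × ℍ[ℝ]) =
      (quotientDeriv 1 (γ 0 : CP 3) (velocity (E := Fin 3 → ℂ) γ),
        ε • quotientDeriv quaternionI (γ 0 : CP 3) (velocity (E := Fin 3 → ℂ) γ)) := by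
  have h1 := hasDerivAt_quotient_comp_curve baseCoordinate_mk hγ
  have h2 := hasDerivAt_quotient_comp_curve fibreCoordinate_mk hγ
  have h3 : HasDerivAt (fun t => twistorPair ε (γ t)) _ 0 := h1.prodMk (h2.const_smul ε)
  have h4 : (velocity (E := ℍ[ℝ] × ℍ[ℝ]) (fun t => quadricEquiv hε (γ t)) : ℍ[ℝ] × ℍ[ℝ]) =
      fderiv ℝ (fun t => twistorPair ε (γ t)) 0 1 := by
    rw [velocity, mfderiv_eq_fderiv]
    rfl
  rw [h4, h3.hasFDerivAt.fderiv]
  exact one_smul ℝ _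

/-- Tangency of `i w` is orthogonality of `dx * u` to `x`; right multiplication by `u` is skew, so
this is orthogonality of `dx` to `x * u`. -/
theorem mem_hypersurfaceLevi_quadric_iff {p : quadric} {w : Fin 3 → ℂ}
    (hw : w ∈ tangentSet (E := Fin 3 → ℂ) quadric p) :
    w ∈ hypersurfaceLevi (E := Fin 3 → ℂ) quadric p ↔
      ⟪quotientDeriv 1 (p : CP 3) w, fibreCoordinate p⟫ = 0 := by
  have hd := denominator_normRep_ne_zero p.2
  have hu := re_eq_zero_and_inner_self_eq_one (u := fibreUnit (normRep (p : CP 3)))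
    (mul_mul_inv_mem_imaginaryUnits hd)
  have hI : ⟪baseCoordinate p, quotientDeriv 1 (p : CP 3) (Complex.I • w)⟫ =
      -⟪quotientDeriv 1 (p : CP 3) w, fibreCoordinate p⟫ := by
    rw [quotientDeriv_I_smul (by rw [mul_one, one_mul]) hd, fibreCoordinate_eq hd,
      real_inner_comm, inner_mul_right_of_re_eq_zero hu.1]
  constructor
  · rintro ⟨-, h⟩
    rw [← neg_eq_zero, ← hI]
    exact inner_baseCoordinate_quotientDeriv h
  · intro h
    exact ⟨hw, mem_tangentSet_quadric (hI.trans (by rw [h, neg_zero]))⟩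

theorem inner_fibreCoordinate {e : CP 3} (he : e ∈ quadric) :
    ⟪fibreCoordinate e, fibreCoordinate e⟫ = 1 ∧ ⟪baseCoordinate e, fibreCoordinate e⟫ = 0 := by
  have h := twistorPair_mem (one_mul (1 : ℝ)) he
  rw [twistorPair, one_smul] at h
  exact (mem_tangentSphereBundle_iff_inner.1 h).2

/-- Since `b` is orthogonal to `x`, it is its own vertical part. The correction term of the
horizontal lift also vanishes, because `⟪a * u, x * u⟫ = ⟪a, x⟫ = 0`. -/
theorem sphereBundleJ_eq {ε : ℝ} (hε : ε * ε = 1) {x u a b : ℍ[ℝ]}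
    {p : tangentSphereBundle} (hp : (p : ℍ[ℝ] × ℍ[ℝ]) = (x, ε • (x * u))) (hx : ⟪x, x⟫ = 1) (hu : u ∈ imaginaryUnits)
    (hxa : ⟪x, a⟫ = 0) (hua : ⟪x * u, a⟫ = 0) (hxb : ⟪x, b⟫ = 0) (hub : ⟪x * u, b⟫ = 0) :
    (sphereBundleJ ε p ((a, b) : ℍ[ℝ] × ℍ[ℝ]) : ℍ[ℝ] × ℍ[ℝ]) = (a * u, b * u) := by
  obtain ⟨_, h⟩ := p
  subst hp
  have h1 : verticalPart (x, ε • (x * u)) (a, b) = b := by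
    rw [verticalPart, real_inner_comm, hxb, zero_smul, sub_zero]
  have h2 : ⟪a * u, ε • (x * u)⟫ = 0 := by
    rw [inner_smul_right, inner_mul_mul_right, real_inner_comm x a, hxa, mul_zero, mul_zero]
  change horizontalLift (x, ε • (x * u)) (crossProduct ε x (ε • (x * u)) a) +
    (0, crossProduct ε x (ε • (x * u)) (verticalPart (x, ε • (x * u)) (a, b))) = _
  rw [h1, crossProduct_eq hε hx hu hxa hua, crossProduct_eq hε hx hu hxb hub, horizontalLift, h2,
    neg_zero, zero_smul]
  exact Prod.ext (add_zero (a * u)) (zero_add (b * u))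

theorem isCRIsomorphism_quadricEquiv {ε : ℝ} (hε : ε * ε = 1) :
    IsCRIsomorphism (E := Fin 3 → ℂ) (F := ℍ[ℝ] × ℍ[ℝ]) (hypersurfaceLevi quadric)
      (fun e => tangentI (e : CP 3)) sphereBundleLevi (sphereBundleJ ε) (quadricEquiv hε) where
  smooth := isSmoothMap_quadricEquiv hε
  smooth_symm := isSmoothMap_quadricEquiv_symm hε
  levi := by
    rintro _ w w' ⟨γ, hγ, rfl, rfl, rfl⟩
    have hw : velocity (E := Fin 3 → ℂ) γ ∈ tangentSet (E := Fin 3 → ℂ) quadric (γ 0) :=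
      ⟨γ, hγ, rfl, rfl⟩
    have hw' : velocity (E := ℍ[ℝ] × ℍ[ℝ]) (fun t => quadricEquiv hε (γ t)) ∈
        tangentSet (E := ℍ[ℝ] × ℍ[ℝ]) tangentSphereBundle (quadricEquiv hε (γ 0)) :=
      ⟨_, isSmoothCurve_quadricEquiv hε hγ, rfl, rfl⟩
    have hε0 : ε ≠ 0 := by
      rintro rfl
      simp at hε
    refine (mem_hypersurfaceLevi_quadric_iff hw).trans ?_
    refine Iff.trans ?_ (and_iff_right hw').symm
    have hv := congrArg Prod.fst (velocity_quadricEquiv hε hγ)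
    change _ ↔ ⟪(velocity (E := ℍ[ℝ] × ℍ[ℝ]) (fun t => quadricEquiv hε (γ t)) : ℍ[ℝ] × ℍ[ℝ]).1,
      ε • fibreCoordinate (γ 0)⟫ = 0
    rw [hv, inner_smul_right, mul_eq_zero, or_iff_right hε0]
  complex := by
    rintro _ w w' hwH ⟨γ, hγ, rfl, rfl, rfl⟩
    -- Membership in the Levi distribution supplies a curve `γ'` with velocity `i w`; it is the
    -- witness for the differential at `i w`.
    obtain ⟨hw, γ', hγ', hγ0, hvel⟩ := hwH
    refine ⟨γ', hγ', hγ0, hvel, ?_⟩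
    have hd := denominator_normRep_ne_zero (γ 0).2
    have hlevi : ⟪quotientDeriv 1 (γ 0 : CP 3) (velocity (E := Fin 3 → ℂ) γ),
        fibreCoordinate (γ 0)⟫ = 0 :=
      (mem_hypersurfaceLevi_quadric_iff hw).1 ⟨hw, γ', hγ', hγ0, hvel⟩
    have hbase := hasDerivAt_quotient_comp_curve baseCoordinate_mk hγ
    have hfibre := hasDerivAt_quotient_comp_curve fibreCoordinate_mk hγ
    have hxb : ⟪baseCoordinate (γ 0),
        quotientDeriv quaternionI (γ 0 : CP 3) (velocity (E := Fin 3 → ℂ) γ)⟫ = 0 := by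
      -- Differentiating `⟪x, v⟫ = 0` gives `⟪x, v'⟫ = -⟪x', v⟫`, and the right side vanishes on the
      -- Levi distribution.
      have h1 := hbase.inner ℝ hfibre
      simp only [fun t => (inner_fibreCoordinate (γ t).2).2] at h1
      have h2 := h1.unique (hasDerivAt_const 0 (0 : ℝ))
      linarith
    have hub := inner_eq_zero_of_hasDerivAt hfibre fun t => (inner_fibreCoordinate (γ t).2).1
    have hderiv : ∀ s, quaternionI * s = s * quaternionI →
        quotientDeriv s (γ' 0 : CP 3) (velocity (E := Fin 3 → ℂ) γ') =
          quotientDeriv s (γ 0 : CP 3) (velocity (E := Fin 3 → ℂ) γ) *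
            fibreUnit (normRep (γ 0 : CP 3)) := by
      intro s hs
      refine Eq.trans ?_ (quotientDeriv_I_smul hs hd _)
      exact (congrArg (quotientDeriv s _) hvel).trans (by rw [hγ0]; rfl)
    rw [fibreCoordinate_eq hd] at hlevi hub
    refine (velocity_quadricEquiv hε hγ').trans ?_
    rw [hderiv 1 (by rw [mul_one, one_mul]), hderiv quaternionI rfl, ← smul_mul_assoc]
    refine Eq.trans ?_ (congrArg (sphereBundleJ ε (quadricEquiv hε (γ 0)))
      (velocity_quadricEquiv hε hγ)).symm
    refine (sphereBundleJ_eq hε (p := quadricEquiv hε (γ 0)) ?_ (inner_baseCoordinate (γ 0).2)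
      (mul_mul_inv_mem_imaginaryUnits hd) ?_ ?_ ?_ ?_).symm
    · exact congrArg (fun v => (baseCoordinate (γ 0 : CP 3), ε • v)) (fibreCoordinate_eq hd)
    · exact inner_baseCoordinate_quotientDeriv hw
    · rw [real_inner_comm]
      exact hlevi
    · rw [inner_smul_right, hxb, mul_zero]
    · rw [inner_smul_right]
      exact mul_eq_zero_of_right _ hub

end TwistorCR

end

/-! ### The main theorem. -/

open TwistorCR
theorem mainTheorem6 (ε : ℝ) (hε : ε = 1 ∨ ε = -1) :
    -- `x ↦ [x : 1]` identifies the unit sphere of the quaternions with `S³ ⊆ HP¹`,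
    -- and `Q` is the set of null lines of the Hermitian form
    Set.BijOn affinePoint (Metric.sphere 0 1) sphereInHP1 ∧
    quadric = {e : CP 3 | ∀ z ∈ e.submodule, hermitianForm z z = 0} ∧
    -- the points of `Q` over `x ∈ S³` are the Hermitian almost complex structures `J` of the
    -- tangent space at `x`, and `J ↦ J(N)` maps these bijectively to the unit tangent vectors
    (∀ e ∈ quadric, ∃! J, IsTwistorStructure e J) ∧
    (∀ e ∈ quadric, ∀ J, IsTwistorStructure e J → J ∈ hermitianStructures) ∧
    (∀ x ∈ Metric.sphere (0 : ℍ[ℝ]) 1, ∀ J ∈ hermitianStructures,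
      ∃! e : CP 3, twistorProjection e = affinePoint x ∧ IsTwistorStructure e J) ∧
    (∀ x ∈ Metric.sphere (0 : ℍ[ℝ]) 1, Set.BijOn (fun J : ℍ[ℝ] →ₗ[ℝ] ℍ[ℝ] => J (unitNormal ε x))
      hermitianStructures {v | (x, v) ∈ tangentSphereBundle}) ∧
    -- the resulting bundle map `Q → SS³` over `S³` is a CR isomorphism
    ∃ f : quadric ≃ tangentSphereBundle,
      (∀ e : quadric, twistorProjection e = affinePoint (f e).1.1) ∧
      (∀ (e : quadric) (J : ℍ[ℝ] →ₗ[ℝ] ℍ[ℝ]), IsTwistorStructure e J →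
        (f e).1.2 = J (unitNormal ε (f e).1.1)) ∧
      IsCRIsomorphism (E := Fin 3 → ℂ) (F := ℍ[ℝ] × ℍ[ℝ]) (hypersurfaceLevi quadric) (fun e => tangentI (e : CP 3))
        sphereBundleLevi (sphereBundleJ ε) f := by
  -- The choice of orientation enters the proof only through `ε² = 1`.
  have hε2 : ε * ε = 1 := by
    rcases hε with rfl | rfl <;> norm_num
  have hsphere : ∀ x ∈ Metric.sphere (0 : ℍ[ℝ]) 1, ⟪x, x⟫ = 1 := by
    intro x hx
    rw [real_inner_self_eq_norm_sq, mem_sphere_zero_iff_norm.1 hx, one_pow]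
  refine ⟨bijOn_affinePoint, quadric_eq, fun e he => ?_, fun e he J hJ => ?_,
    fun x hx J hJ => existsUnique_isTwistorStructure (hsphere x hx) hJ,
    fun x hx => bijOn_hermitianStructures hε2 (hsphere x hx),
    quadricEquiv hε2, fun e => ?_, fun e J hJ => ?_, isCRIsomorphism_quadricEquiv hε2⟩
  · exact ⟨_, (isTwistorStructure_iff (denominator_normRep_ne_zero he)).2 rfl,
      fun J hJ => (isTwistorStructure_iff (denominator_normRep_ne_zero he)).1 hJ⟩
  · rw [(isTwistorStructure_iff (denominator_normRep_ne_zero he)).1 hJ]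
    exact mulRight_mem_hermitianStructures
      (mul_mul_inv_mem_imaginaryUnits (denominator_normRep_ne_zero he))
  · have hd := denominator_normRep_ne_zero e.2
    change twistorProjection (e : CP 3) = affinePoint (baseCoordinate (e : CP 3))
    conv_lhs => rw [← mk_normRep (e : CP 3)]
    rw [twistorProjection_mk_eq_affinePoint]
    refine ⟨hd, ?_⟩
    conv_rhs => rw [← mk_normRep (e : CP 3)]
    rw [baseCoordinate_mk, mk_normRep, mul_one, inv_mul_cancel_right₀ hd]
  · have hd := denominator_normRep_ne_zero e.2
    rw [(isTwistorStructure_iff hd).1 hJ, LinearMap.mulRight_apply, unitNormal, smul_mul_assoc]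
    exact congrArg (ε • ·) (fibreCoordinate_eq hd)
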